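/- **Setting.** Let $\Gamma=\mathbb Z_2*\mathbb Z_2*\mathbb Z_2*\mathbb Z_2$ with generators $A,B,C,D$ of order two, and let $\widetilde\Gamma$ be the subgroup generated by $A,B,C$. A *4-colored graph* is a simple graph $G$ with a proper edge coloring by $A,B,C,D$. Then $\Gamma$ acts on its vertices: a generator $c$ moves a vertex $v$ along the edge of color $c$ at $v$ if there is one, and fixes $v$ otherwise. *Type space.* The $r$-type $\alpha_r(x)$ of a vertex $x$ is the isomorphism class of the rooted colored ball $B_r(x)$ (the subgraph spanned by the vertices at distance at most $r$ from $x$, with root $x$). Write $\alpha\prec\beta$ if the $r$-ball around the root of the $(r+1)$-type $\beta$ is the $r$-type $\alpha$. The type space $X_G$ is the compact space of all infinite chains $\alpha_1\prec\alpha_2\prec\cdots$ of $r$-types $\alpha_r$ that occur in $G$, with the metric $2^{-r}$, $r$ being the first index at which two chains differ. The action extends to an action $\widetilde\Phi$ of $\Gamma$ on $X_G$: a generator $c$ sends $(\alpha_r)_r$ to $(\beta_r)_r$, $\beta_r=\alpha_r(c\cdot x)$ for any vertex $x$ of $(r+1)$-type $\alpha_{r+1}$. The graphing $\mathcal G$ of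 $\widetilde\Phi$ is the simple graph on $X_G$ in which two distinct points are adjacent if one of $A,B,C,D$ maps one to the other. For a Borel measure $\mu$ on $X_G$, the edge measure is $e(\mathcal G,\mu)=\frac12\int_{X_G}\deg_{\mathcal G}\,d\mu$. *The graphs $G^{(m)}$.* Fix a decreasing sequence $N_1,N_2,\dots$ of normal subgroups of finite index in $\widetilde\Gamma$ with trivial intersection; let $K_i$ be the $3$-colored Cayley graph of $\widetilde\Gamma/N_i$, and $C_i$ the cycle of length $2i$ with edges colored alternately by $A$ and $B$. List the nontrivial reduced words of $\Gamma$ by length and then lexicographically as $A,B,C,D,AB,AC,\dots$. For an integer $m>10$, a graph $G^{(m)}=\bigcup_n G_n$ is constructed with arbitrary choices as follows, where $s_i=m^i2^{|V(G_{i-1})|}$. The graph $G_0$ is a single vertex $r_0$. $G_1$ is obtained by joining $r_0$ by an edge of color $D$ to a vertex of a triangle $H_1$ with edges of colors $A,B,C$; another vertex of $H_1$ is called $r_1$. For $n\ge2$ choose $H_n$ isomorphic to some $C_i$ if $n$ is even, and to some $K_i$ if $n$ is odd, with $\operatorname{diam}H_n\ge10s_n$, and a partition $V(H_n)=R^n_1\sqcup\dots\sqcup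 R^n_{n+1}$ such that, for $1\le i\le n$, distinct points of $R^n_i$ have distance at least $2s_i$ in $H_n$, and every vertex of $H_n$ has distance at most $10s_i$ to $R^n_i$. The graph $G_n$ consists of $H_n$ together with: for $1\le i\le n-1$ and each $u\in R^n_i$, a new copy of $G_{i-1}$, whose vertex $r_{i-1}$ is joined to $u$ by an edge of color $D$; the graph $G_{n-1}$ itself, whose vertex $r_{n-1}$ is joined to one vertex of $R^n_n$ by an edge of color $D$; and a new path that starts at a vertex $x_n\in R^n_{n+1}$ and whose successive edges have the colors $w_1,\dots,w_k$ if $w_1=D$, and $D,w_1,\dots,w_k$ if $w_1\ne D$, where $w_k\cdots w_1$ is the $n$-th word of the list (for $n=2$: the first word). Finally another vertex of $R^n_{n+1}$ is called $r_n$. *The measure $\mu_1^{(m)}$.* Fix a nonprincipal ultrafilter $\omega$ on $\mathbb N$ and put $\Omega_n=V(G_n)\setminus V(G_{n-1})$. Then $\mu_1^{(m)}$ is the Borel measure on $X_{G^{(m)}}$ which gives to the set of chains through an $r$-type $\alpha$ the mass $$\lim_{\omega}\frac{|\{v\in\Omega_{2n}:\alpha_r(v)=\alpha\}|}{|\Omega_{2n}|}.$$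 **Proposition.** Let $G^{(m)}$, $m>10$, be constructed in this way, with any choices, and let $\mathcal G^{(m)}$ be the graphing of the action of $\Gamma$ on $X_{G^{(m)}}$. Then for every $m>10$ $$\mu_1^{(m)}\bigl(\{x\in X_{G^{(m)}}:\deg_{\mathcal G^{(m)}}(x)>2\}\bigr)\le\frac2m,$$ and $$\lim_{m\to\infty}e(\mathcal G^{(m)},\mu_1^{(m)})=1 .$$ -/

import Mathlib

open Set Filter Topology MeasureTheory
open scoped ENNReal

noncomputable section

namespace TypeSpaceAction

/-! ### Colored graphs -/

/-- The four edge colors. -/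
inductive Color
  | A | B | C | D
  deriving DecidableEq

instance : Finite Color :=
  Finite.of_injective
    (fun c : Color => match c with
      | .A => (0 : Fin 4) | .B => 1 | .C => 2 | .D => 3)
    (by intro a b h; cases a <;> cases b <;> simp_all)

/-- A simple graph with a proper edge coloring by `A, B, C, D`:
`edge c u v` says that `u` and `v` are joined by an edge of color `c`. -/
structure ColoredGraph (V : Type*) where
  edge : Color → V → V → Prop
  symm : ∀ {c : Color} {u v : V}, edge c u v → edge c v u
  irrefl : ∀ {c : Color} {v : V}, ¬ edge c v v
  color_unique : ∀ {c c' : Color} {u v : V}, edge c u v → edge c' u v → c = c'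
  proper : ∀ {c : Color} {u v w : V}, edge c u v → edge c u w → v = w

namespace ColoredGraph

variable {V : Type*} (G : ColoredGraph V)

/-- The underlying simple graph. -/
def toSimpleGraph : SimpleGraph V where
  Adj u v := ∃ c, G.edge c u v
  symm := ⟨fun _ _ ⟨c, h⟩ => ⟨c, G.symm h⟩⟩
  loopless := ⟨fun _ ⟨_, h⟩ => G.irrefl h⟩

open Classical in
/-- The letter `c` moves `v` along the edge of color `c` at `v`, if there is one, and fixes `v`
otherwise. -/
def step (c : Color) (v : V) : V :=
  if h : ∃ w, G.edge c v w then h.choose else v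

lemma step_of_edge {c : Color} {v w : V} (h : G.edge c v w) : G.step c v = w := by
  have h' : ∃ w, G.edge c v w := ⟨w, h⟩
  rw [step, dif_pos h']
  exact G.proper h'.choose_spec h

lemma step_of_not {c : Color} {v : V} (h : ¬ ∃ w, G.edge c v w) : G.step c v = v := by
  rw [step, dif_neg h]

lemma step_step (c : Color) (v : V) : G.step c (G.step c v) = v := by
  by_cases h : ∃ w, G.edge c v w
  · obtain ⟨w, hw⟩ := h
    rw [G.step_of_edge hw, G.step_of_edge (G.symm hw)]
  · rw [G.step_of_not h, G.step_of_not h]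

/-- The action of a word `w_k ⋯ w_1` on a vertex; `w_1` is applied first. -/
def wordStep (w : List Color) (v : V) : V := w.foldr G.step v

lemma wordStep_append (w : List Color) (c : Color) (v : V) :
    G.wordStep (w ++ [c]) v = G.wordStep w (G.step c v) := by
  simp [wordStep]

/-- The vertex set of the ball `B_r(x)`. -/
def ball (r : ℕ) (x : V) : Set V := {y | G.toSimpleGraph.edist x y ≤ r}

/-- The rooted colored balls `B_r(x)` and `B_r(y)` (spanned subgraphs) are isomorphic, by an
isomorphism that preserves the colors and sends `x` to `y`. -/
def BallEquiv (r : ℕ) (x y : V) : Prop :=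
  ∃ θ : G.ball r x ≃ G.ball r y,
    (∀ u : G.ball r x, (u : V) = x → (θ u : V) = y) ∧
    ∀ (c : Color) (u v : G.ball r x), G.edge c u v ↔ G.edge c (θ u) (θ v)

lemma mem_ball_self (r : ℕ) (x : V) : x ∈ G.ball r x := by
  simp [ball]

/-- "Having the same `r`-type" is an equivalence relation. -/
def ballSetoid (r : ℕ) : Setoid V where
  r := G.BallEquiv r
  iseqv :=
    { refl := fun x => ⟨Equiv.refl _, fun _ h => h, fun _ _ _ => Iff.rfl⟩
      symm := by
        rintro x y ⟨θ, hθ, he⟩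
        refine ⟨θ.symm, fun u hu => ?_, fun c u v => ?_⟩
        · have h1 : θ ⟨x, G.mem_ball_self r x⟩ = u := Subtype.ext ((hθ _ rfl).trans hu.symm)
          rw [← h1, Equiv.symm_apply_apply]
        · simp [he]
      trans := by
        rintro x y z ⟨θ, hθ, he⟩ ⟨η, hη, hf⟩
        refine ⟨θ.trans η, fun u hu => hη _ (hθ u hu), fun c u v => ?_⟩
        rw [he, hf]; rfl }

lemma wordStep_mem_ball (x : V) (w : List Color) {r : ℕ} (hr : w.length ≤ r) :
    G.wordStep w x ∈ G.ball r x := by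
  have key : ∀ w : List Color, G.toSimpleGraph.edist x (G.wordStep w x) ≤ w.length := by
    intro w
    induction w with
    | nil => simp [wordStep]
    | cons c w ih =>
      have h1 : G.toSimpleGraph.edist (G.wordStep w x) (G.step c (G.wordStep w x)) ≤ 1 := by
        rw [SimpleGraph.edist_le_one_iff_adj_or_eq]
        by_cases h : ∃ v, G.edge c (G.wordStep w x) v
        · obtain ⟨v, hv⟩ := h
          rw [G.step_of_edge hv]
          exact Or.inl ⟨c, hv⟩
        · exact Or.inr (G.step_of_not h).symm
      calc G.toSimpleGraph.edist x (G.wordStep (c :: w) x)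
          ≤ G.toSimpleGraph.edist x (G.wordStep w x) +
            G.toSimpleGraph.edist (G.wordStep w x) (G.step c (G.wordStep w x)) :=
            SimpleGraph.edist_triangle
        _ ≤ w.length + 1 := add_le_add ih h1
        _ = ((c :: w).length : ℕ∞) := by simp
  exact (key w).trans (by exact_mod_cast hr)

lemma exists_word_of_mem_ball {x y : V} {r : ℕ} (h : y ∈ G.ball r x) :
    ∃ w : List Color, w.length ≤ r ∧ G.wordStep w x = y := by
  have hne : G.toSimpleGraph.edist x y ≠ ⊤ := ne_top_of_le_ne_top (ENat.natCast_ne_top r) h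
  obtain ⟨p, hp⟩ := SimpleGraph.exists_walk_of_edist_ne_top hne
  have hlen : p.length ≤ r := by
    have : (p.length : ℕ∞) ≤ r := hp ▸ h
    exact_mod_cast this
  have key : ∀ {a b : V} (p : G.toSimpleGraph.Walk a b),
      ∃ w : List Color, w.length = p.length ∧ G.wordStep w a = b := by
    intro a b p
    induction p with
    | nil => exact ⟨[], rfl, rfl⟩
    | cons hadj p ih =>
      obtain ⟨w, hw, hb⟩ := ih
      obtain ⟨c, hc⟩ := hadj
      exact ⟨w ++ [c], by rw [List.length_append, hw]; rfl, by rw [wordStep_append, G.step_of_edge hc, hb]⟩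
  obtain ⟨w, hw, hy⟩ := key p
  exact ⟨w, hw.trans_le hlen, hy⟩

/-- A description of the rooted ball `B_r(x)` through the words of length at most `r`. -/
def SamePattern (r : ℕ) (x y : V) : Prop :=
  ∀ w w' : List Color, w.length ≤ r → w'.length ≤ r →
    (G.wordStep w x = G.wordStep w' x ↔ G.wordStep w y = G.wordStep w' y) ∧
    ∀ c, G.edge c (G.wordStep w x) (G.wordStep w' x) ↔
      G.edge c (G.wordStep w y) (G.wordStep w' y)

lemma ballEquiv_iff_samePattern (r : ℕ) (x y : V) :
    G.BallEquiv r x y ↔ G.SamePattern r x y := by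
  constructor
  · rintro ⟨θ, hθ, he⟩
    have key : ∀ (w : List Color) (hw : w.length ≤ r),
        (θ ⟨G.wordStep w x, G.wordStep_mem_ball x w hw⟩ : V) = G.wordStep w y := by
      intro w
      induction w with
      | nil => intro _; exact hθ _ rfl
      | cons c w ih =>
        intro hw
        have hw' : w.length ≤ r := by simp at hw; omega
        have ih := ih hw'
        by_cases h : ∃ v, G.edge c (G.wordStep w x) v
        · obtain ⟨v, hv⟩ := h
          have e1 : G.wordStep (c :: w) x = v := G.step_of_edge hv
          have hvm : v ∈ G.ball r x := e1 ▸ G.wordStep_mem_ball x (c :: w) hw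
          have h2 := (he c ⟨_, G.wordStep_mem_ball x w hw'⟩ ⟨v, hvm⟩).1 hv
          rw [ih] at h2
          have e2 : G.wordStep (c :: w) y = θ ⟨v, hvm⟩ := G.step_of_edge h2
          rw [e2]
          congr 2
          exact Subtype.ext e1
        · have h' : ¬ ∃ v, G.edge c (G.wordStep w y) v := by
            rintro ⟨v, hv⟩
            have e1 : G.wordStep (c :: w) y = v := G.step_of_edge hv
            have hvm : v ∈ G.ball r y := e1 ▸ G.wordStep_mem_ball y (c :: w) hw
            refine h ⟨θ.symm ⟨v, hvm⟩, ?_⟩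
            refine (he c ⟨_, G.wordStep_mem_ball x w hw'⟩ (θ.symm ⟨v, hvm⟩)).2 ?_
            rw [ih, Equiv.apply_symm_apply]
            exact hv
          have e1 : G.wordStep (c :: w) x = G.wordStep w x := G.step_of_not h
          have e2 : G.wordStep (c :: w) y = G.wordStep w y := G.step_of_not h'
          rw [e2, ← ih]
          congr 2
          exact Subtype.ext e1
    intro w w' hw hw'
    refine ⟨?_, fun c => ?_⟩
    · rw [← key w hw, ← key w' hw', ← Subtype.ext_iff, θ.apply_eq_iff_eq, Subtype.mk.injEq]
    · rw [← key w hw, ← key w' hw']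
      exact he c ⟨_, G.wordStep_mem_ball x w hw⟩ ⟨_, G.wordStep_mem_ball x w' hw'⟩
  · intro h
    choose f hf hfx using fun u : G.ball r x => G.exists_word_of_mem_ball u.2
    choose g hg hgy using fun u : G.ball r y => G.exists_word_of_mem_ball u.2
    refine ⟨⟨fun u => ⟨G.wordStep (f u) y, G.wordStep_mem_ball y _ (hf u)⟩,
      fun u => ⟨G.wordStep (g u) x, G.wordStep_mem_ball x _ (hg u)⟩, fun u => ?_, fun u => ?_⟩,
      fun u hu => ?_, fun c u v => ?_⟩
    · apply Subtype.ext
      refine Eq.trans ?_ (hfx u)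
      exact (h _ _ (hg _) (hf u)).1.2 (hgy _)
    · apply Subtype.ext
      refine Eq.trans ?_ (hgy u)
      exact (h _ _ (hf _) (hg u)).1.1 (hfx _)
    · have := (h (f u) [] (hf u) (Nat.zero_le _)).1.1 ((hfx u).trans hu)
      exact this
    · have := (h (f u) (f v) (hf u) (hf v)).2 c
      rw [hfx, hfx] at this
      exact this

lemma SamePattern.mono {r s : ℕ} (hrs : r ≤ s) {x y : V} (h : G.SamePattern s x y) :
    G.SamePattern r x y :=
  fun w w' hw hw' => h w w' (hw.trans hrs) (hw'.trans hrs)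

lemma BallEquiv.mono {r s : ℕ} (hrs : r ≤ s) {x y : V} (h : G.BallEquiv s x y) :
    G.BallEquiv r x y := by
  rw [ballEquiv_iff_samePattern] at h ⊢
  exact SamePattern.mono G hrs h

lemma BallEquiv.step {r : ℕ} {x y : V} (c : Color) (h : G.BallEquiv (r + 1) x y) :
    G.BallEquiv r (G.step c x) (G.step c y) := by
  rw [ballEquiv_iff_samePattern] at h ⊢
  intro w w' hw hw'
  have := h (w ++ [c]) (w' ++ [c]) (by simpa using hw) (by simpa using hw')
  simpa only [wordStep_append] using this

/-! ### The type space -/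

/-- The set `U^r_G` of `r`-types of `G`: isomorphism classes of the rooted colored balls
`B_r(x)`, `x ∈ V`. -/
def RType (r : ℕ) : Type _ := Quotient (G.ballSetoid r)

/-- The `r`-type `α_r(x)` of a vertex. -/
def rtype (r : ℕ) (x : V) : G.RType r := Quotient.mk (G.ballSetoid r) x

lemma rtype_eq_iff {r : ℕ} {x y : V} : G.rtype r x = G.rtype r y ↔ G.BallEquiv r x y :=
  ⟨fun h => Quotient.exact h, fun h => Quotient.sound h⟩

/-- `α ≺ β`: the `r`-ball around the root of the `(r+1)`-type `β` is `α`. -/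
def Prec {r : ℕ} (α : G.RType r) (β : G.RType (r + 1)) : Prop :=
  ∃ x : V, G.rtype r x = α ∧ G.rtype (r + 1) x = β

/-- The type space `X_G`: infinite chains `α_0 ≺ α_1 ≺ α_2 ≺ ⋯` of types. (There is only one
`0`-type, so starting the chains at `0` instead of `1` makes no difference.) -/
structure TypeSpace where
  types : ∀ r, G.RType r
  prec : ∀ r, G.Prec (types r) (types (r + 1))

instance (r : ℕ) : TopologicalSpace (G.RType r) := ⊥

instance (r : ℕ) : DiscreteTopology (G.RType r) := ⟨rfl⟩

/-- The topology of `X_G` is induced by the product of the discrete topologies; it is the topology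
of the metric `d(a, b) = 2^{-r}`, `r` being the least index at which `a` and `b` differ. -/
instance : TopologicalSpace G.TypeSpace := TopologicalSpace.induced TypeSpace.types inferInstance

instance : MeasurableSpace G.TypeSpace := borel _

instance : BorelSpace G.TypeSpace := ⟨rfl⟩

/-- The chain `π(x)` of the types of a vertex. -/
def toTypeSpace (x : V) : G.TypeSpace := ⟨fun r => G.rtype r x, fun _ => ⟨x, rfl, rfl⟩⟩

/-- The clopen set of the chains whose `r`-th term is `α`. -/
def cylinder (r : ℕ) (α : G.RType r) : Set G.TypeSpace := {a | a.types r = α}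

instance finite_rtype (r : ℕ) : Finite (G.RType r) := by
  let L := {w : List Color // w.length ≤ r}
  have : Finite L := List.finite_length_le Color r
  let f : V → Set (L × L) × Set (L × L × Color) := fun x =>
    ({p | G.wordStep p.1.1 x = G.wordStep p.2.1 x},
     {p | G.edge p.2.2 (G.wordStep p.1.1 x) (G.wordStep p.2.1.1 x)})
  refine Finite.of_injective (fun a : G.RType r => f (Quotient.out a)) ?_
  intro a b hab
  have h : G.BallEquiv r (Quotient.out a) (Quotient.out b) := by
    rw [ballEquiv_iff_samePattern]
    intro w w' hw hw'
    simp only [f, Prod.mk.injEq] at hab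
    refine ⟨?_, fun c => ?_⟩
    · exact Set.ext_iff.1 hab.1 (⟨w, hw⟩, ⟨w', hw'⟩)
    · exact Set.ext_iff.1 hab.2 (⟨w, hw⟩, ⟨w', hw'⟩, c)
  have := Quotient.sound (s := G.ballSetoid r) h
  exact (Quotient.out_eq a).symm.trans (this.trans (Quotient.out_eq b))

lemma isEmbedding_types : Topology.IsEmbedding (TypeSpace.types (G := G)) :=
  ⟨⟨rfl⟩, fun a b h => by cases a; cases b; cases h; rfl⟩

instance : T2Space G.TypeSpace := G.isEmbedding_types.t2Space

instance : CompactSpace G.TypeSpace := by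
  have hr : range (TypeSpace.types (G := G)) =
      ⋂ r, {a : ∀ r, G.RType r | G.Prec (a r) (a (r + 1))} := by
    ext a
    simp only [mem_range, mem_iInter]
    exact ⟨fun ⟨b, hb⟩ r => hb ▸ b.prec r, fun h => ⟨⟨a, h⟩, rfl⟩⟩
  have hcl : IsClosed (range (TypeSpace.types (G := G))) := by
    rw [hr]
    refine isClosed_iInter fun r => ?_
    have hc : Continuous fun a : ∀ r, G.RType r => (a r, a (r + 1)) := by fun_prop
    exact (isClosed_discrete {p : G.RType r × G.RType (r + 1) | G.Prec p.1 p.2}).preimage hc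
  exact (Topology.IsClosedEmbedding.mk G.isEmbedding_types hcl).compactSpace

lemma isClopen_cylinder (r : ℕ) (α : G.RType r) : IsClopen (G.cylinder r α) := by
  have hc : Continuous fun a : G.TypeSpace => a.types r :=
    (continuous_apply r).comp G.isEmbedding_types.continuous
  exact (isClopen_discrete {α}).preimage hc

/-! ### The action of the free product of four groups of order two -/

end ColoredGraph

/-- `Γ = ℤ₂ * ℤ₂ * ℤ₂ * ℤ₂`, with one factor for each color. -/
abbrev Gam : Type := Monoid.CoprodI fun _ : Color => Multiplicative (ZMod 2)

/-- The generator of `Γ` that belongs to a color. -/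
def gen (c : Color) : Gam :=
  Monoid.CoprodI.of (M := fun _ : Color => Multiplicative (ZMod 2)) (i := c)
    (Multiplicative.ofAdd 1)

/-- The subgroup of `Γ` that is generated by `A`, `B`, `C`. -/
def GamTilde : Subgroup Gam := Subgroup.closure {gen Color.A, gen Color.B, gen Color.C}

/-- The homomorphism from `ℤ₂` that sends the generator to the involution `f`. -/
def involutionHom {X : Type*} (f : X → X) (hf : Function.Involutive f) :
    Multiplicative (ZMod 2) →* Equiv.Perm X :=
  AddMonoidHom.toMultiplicativeLeft
    (ZMod.lift 2 ⟨(zmultiplesHom (Additive (Equiv.Perm X))) (Additive.ofMul hf.toPerm), by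
      change Additive.ofMul (hf.toPerm ^ (2 : ℤ)) = Additive.ofMul 1
      congr 1
      ext x
      exact hf x⟩)

/-- The action of `Γ` in which the generator of color `c` acts by the involution `f c`. -/
def actionOfInvolutions {X : Type*} (f : Color → X → X) (hf : ∀ c, Function.Involutive (f c)) :
    Gam →* Equiv.Perm X :=
  Monoid.CoprodI.lift fun c => involutionHom (f c) (hf c)

lemma actionOfInvolutions_gen {X : Type*} (f : Color → X → X)
    (hf : ∀ c, Function.Involutive (f c)) (c : Color) (x : X) :
    actionOfInvolutions f hf (gen c) x = f c x := by
  have : (ZMod.lift 2 ⟨(zmultiplesHom (Additive (Equiv.Perm X)))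
      (Additive.ofMul (hf c).toPerm), by
      change Additive.ofMul ((hf c).toPerm ^ (2 : ℤ)) = Additive.ofMul 1
      congr 1
      ext x
      exact hf c x⟩) (1 : ZMod 2) = Additive.ofMul (hf c).toPerm := by
    have := ZMod.lift_coe 2 (⟨(zmultiplesHom (Additive (Equiv.Perm X)))
      (Additive.ofMul (hf c).toPerm), by
      change Additive.ofMul ((hf c).toPerm ^ (2 : ℤ)) = Additive.ofMul 1
      congr 1
      ext x
      exact hf c x⟩) 1
    simpa using this
  rw [actionOfInvolutions, gen, Monoid.CoprodI.lift_of]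
  change (Additive.toMul _ : Equiv.Perm X) x = _
  erw [this]
  rfl

/-- The Schreier graph of an action of `Γ` with respect to the generators `A, B, C, D`:
two distinct points are adjacent if a generator maps one to the other. -/
def schreierGraph {X : Type*} (Φ : Gam →* Equiv.Perm X) : SimpleGraph X :=
  SimpleGraph.fromRel fun x y => ∃ c, x = Φ (gen c) y

namespace ColoredGraph

variable {V : Type*} (G : ColoredGraph V)

/-- The `r`-type of `c · x`, as a function of the `(r+1)`-type of `x`. -/
def typeStep (c : Color) (r : ℕ) : G.RType (r + 1) → G.RType r :=
  Quotient.lift (fun x => G.rtype r (G.step c x)) fun _ _ h =>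
    G.rtype_eq_iff.2 (BallEquiv.step G c h)

lemma TypeSpace.eq_of_eq {a : G.TypeSpace} {r s : ℕ} (hrs : r ≤ s) {x : V}
    (h : a.types s = G.rtype s x) : a.types r = G.rtype r x := by
  induction s, hrs using Nat.le_induction with
  | base => exact h
  | succ s hs ih =>
    obtain ⟨y, hy, hy'⟩ := a.prec s
    apply ih
    rw [← hy, G.rtype_eq_iff]
    exact BallEquiv.mono G (Nat.le_succ s) (G.rtype_eq_iff.1 (hy'.trans h))

/-- The extension of the action of a generator to the type space: `β_r = α_r(c · x)` for any
vertex `x` with `α_{r+1}(x) = α_{r+1}`. -/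
def spaceStep (c : Color) (a : G.TypeSpace) : G.TypeSpace :=
  ⟨fun r => G.typeStep c r (a.types (r + 1)), fun r => by
    obtain ⟨x, hx, hx'⟩ := a.prec (r + 1)
    exact ⟨G.step c x, congrArg (G.typeStep c r) hx, congrArg (G.typeStep c (r + 1)) hx'⟩⟩

lemma spaceStep_apply {c : Color} {a : G.TypeSpace} {r : ℕ} {x : V}
    (h : a.types (r + 1) = G.rtype (r + 1) x) : (G.spaceStep c a).types r = G.rtype r (G.step c x) := by
  change G.typeStep c r (a.types (r + 1)) = _
  rw [h]; rfl

lemma spaceStep_involutive (c : Color) : Function.Involutive (G.spaceStep c) := by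
  intro a
  apply G.isEmbedding_types.injective
  funext r
  obtain ⟨x, hx⟩ : ∃ x, a.types (r + 2) = G.rtype (r + 2) x := by
    obtain ⟨x, -, hx⟩ := a.prec (r + 1)
    exact ⟨x, hx.symm⟩
  rw [G.spaceStep_apply (G.spaceStep_apply hx), G.step_step]
  exact (TypeSpace.eq_of_eq G (by omega) hx).symm

/-- The action `Φ` of `Γ` on the vertices of `G`. -/
def vertexAction : Gam →* Equiv.Perm V := actionOfInvolutions G.step G.step_step

/-- The action `Φ~` of `Γ` on the type space that extends `Φ`. -/
def spaceAction : Gam →* Equiv.Perm G.TypeSpace :=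
  actionOfInvolutions G.spaceStep G.spaceStep_involutive

/-- The graphing of the action on the type space: the union of the Schreier graphs of its
orbits. -/
def graphing : SimpleGraph G.TypeSpace := schreierGraph G.spaceAction

/-! ### Averaging along a sequence of sets of vertices -/

/-- The average of a function over a finite set. -/
def setAverage (F : Finset V) (f : V → ℝ) : ℝ := (∑ v ∈ F, f v) / (F.card : ℝ)

lemma abs_setAverage_le (F : Finset V) {f : V → ℝ} {C : ℝ} (hC : 0 ≤ C) (hf : ∀ v, |f v| ≤ C) :
    |setAverage F f| ≤ C := by
  rw [setAverage, abs_div, Nat.abs_cast]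
  refine div_le_of_le_mul₀ (Nat.cast_nonneg _) hC ?_
  refine (Finset.abs_sum_le_sum_abs _ _).trans ((Finset.sum_le_sum fun v _ => hf v).trans ?_)
  rw [Finset.sum_const, nsmul_eq_mul, mul_comm]

lemma exists_ulim (ω : Ultrafilter ℕ) {a : ℕ → ℝ} {C : ℝ} (ha : ∀ n, |a n| ≤ C) :
    ∃ l, Tendsto a ω (𝓝 l) := by
  have : (ω.map a : Filter ℝ) ≤ 𝓟 (Icc (-C) C) := by
    rw [le_principal_iff]
    exact Filter.mem_map.2 (univ_mem' fun n => abs_le.1 (ha n))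
  obtain ⟨l, -, hl⟩ := isCompact_Icc.ultrafilter_le_nhds _ this
  exact ⟨l, hl⟩

open Classical in
/-- Averaging: for every ultrafilter `ω` and every sequence `F n` of finite sets
of vertices there is a
Borel measure on `X_G` that gives to the set of the chains through `α` the mass
`lim_ω |{v ∈ F n | α_r(v) = α}| / |F n|`. -/
theorem exists_averageMeasure (ω : Ultrafilter ℕ) (F : ℕ → Finset V) :
    ∃ μ : Measure G.TypeSpace, ∀ (r : ℕ) (α : G.RType r),
      Tendsto (fun n => ((((F n).filter fun v => G.rtype r v = α).card : ℝ≥0∞) / ((F n).card : ℝ≥0∞)))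
        ω (𝓝 (μ (G.cylinder r α))) := by
  let avg : (CompactlySupportedContinuousMap G.TypeSpace ℝ) → ℕ → ℝ :=
    fun f n => setAverage (F n) fun v => f (G.toTypeSpace v)
  have hlim : ∀ f, ∃ l, Tendsto (avg f) ω (𝓝 l) := by
    intro f
    obtain ⟨C, hC⟩ := (isCompact_range f.continuous).isBounded.exists_norm_le
    have hC' : ∀ x, |f x| ≤ |C| := fun x => (hC _ (mem_range_self x)).trans (le_abs_self C)
    exact exists_ulim ω fun n => abs_setAverage_le (F n) (abs_nonneg C) fun v => hC' _
  choose l hl using hlim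
  let Λ : (CompactlySupportedContinuousMap G.TypeSpace ℝ) →ₚ[ℝ] ℝ := PositiveLinearMap.mk₀
    { toFun := l
      map_add' := fun f g => by
        refine tendsto_nhds_unique (hl (f + g)) (((hl f).add (hl g)).congr fun n => ?_)
        simp only [avg, setAverage, ← add_div, ← Finset.sum_add_distrib]
        rfl
      map_smul' := fun c f => by
        refine tendsto_nhds_unique (hl (c • f)) (((hl f).const_mul c).congr fun n => ?_)
        simp only [avg, setAverage, ← mul_div_assoc, Finset.mul_sum]
        rfl }
    (fun f hf => by
      refine ge_of_tendsto (hl f) (Eventually.of_forall fun n => ?_)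
      exact div_nonneg (Finset.sum_nonneg fun v _ => hf _) (Nat.cast_nonneg _))
  refine ⟨RealRMK.rieszMeasure Λ, fun r α => ?_⟩
  have hcl := G.isClopen_cylinder r α
  let χ : CompactlySupportedContinuousMap G.TypeSpace ℝ :=
    ⟨⟨(G.cylinder r α).indicator fun _ => 1, continuous_const.indicator (by simp [hcl])⟩,
      HasCompactSupport.of_compactSpace _⟩
  have h1 : (RealRMK.rieszMeasure Λ).real (G.cylinder r α) = l χ := by
    have h := RealRMK.integral_rieszMeasure Λ χ
    have h' : ∫ x, χ x ∂(RealRMK.rieszMeasure Λ) =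
        (RealRMK.rieszMeasure Λ).real (G.cylinder r α) := by
      change ∫ x, (G.cylinder r α).indicator (1 : G.TypeSpace → ℝ) x ∂_ = _
      rw [integral_indicator_one hcl.isOpen.measurableSet]
    rw [← h', h]; rfl
  have hfin : (RealRMK.rieszMeasure Λ) (G.cylinder r α) ≠ ⊤ :=
    (hcl.isClosed.isCompact.measure_lt_top).ne
  have h2 : Tendsto (fun n => ENNReal.ofReal (avg χ n)) ω
      (𝓝 ((RealRMK.rieszMeasure Λ) (G.cylinder r α))) := by
    rw [← ENNReal.ofReal_toReal hfin]
    change Tendsto _ _ (𝓝 (ENNReal.ofReal ((RealRMK.rieszMeasure Λ).real _)))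
    rw [h1]
    exact (ENNReal.continuous_ofReal.tendsto _).comp (hl χ)
  refine h2.congr fun n => ?_
  have hsum : avg χ n =
      (((F n).filter fun v => G.rtype r v = α).card : ℝ) / ((F n).card : ℝ) := by
    simp only [avg, setAverage]
    congr 1
    have : ∀ v, χ (G.toTypeSpace v) = if G.rtype r v = α then (1 : ℝ) else 0 := by
      intro v
      change (G.cylinder r α).indicator (fun _ => (1 : ℝ)) (G.toTypeSpace v) = _
      rw [Set.indicator_apply]
      rfl
    simp only [this, Finset.sum_boole]
  rw [hsum]
  rcases Nat.eq_zero_or_pos (F n).card with h0 | h0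
  · simp [Finset.card_eq_zero.1 h0]
  · rw [ENNReal.ofReal_div_of_pos (by exact_mod_cast h0), ENNReal.ofReal_natCast,
      ENNReal.ofReal_natCast]

/-- The measure on `X_G` obtained by averaging along `F` and `ω`. Its values on the sets
`G.cylinder r α`, which determine it, are those of `exists_averageMeasure`. -/
def averageMeasure (ω : Ultrafilter ℕ) (F : ℕ → Finset V) : Measure G.TypeSpace :=
  (G.exists_averageMeasure ω F).choose

open Classical in
lemma averageMeasure_cylinder (ω : Ultrafilter ℕ) (F : ℕ → Finset V) (r : ℕ) (α : G.RType r) :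
    Tendsto (fun n => ((((F n).filter fun v => G.rtype r v = α).card : ℝ≥0∞) / ((F n).card : ℝ≥0∞)))
      ω (𝓝 (G.averageMeasure ω F (G.cylinder r α))) :=
  (G.exists_averageMeasure ω F).choose_spec r α

end ColoredGraph

/-- The degree of a point in a graph. -/
def degree {Z : Type*} (𝒢 : SimpleGraph Z) (x : Z) : ℕ∞ := (𝒢.neighborSet x).encard

/-- The edge measure `e(𝒢, μ) = (1/2) ∫ deg_𝒢 dμ`. -/
def edgeMeasure {Z : Type*} [MeasurableSpace Z] (𝒢 : SimpleGraph Z) (μ : Measure Z) : ℝ≥0∞ :=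
  (1 / 2) * ∫⁻ x, (degree 𝒢 x : ℝ≥0∞) ∂μ

/-! ### The words of `Γ` -/

/-- The reduced words of length `k` in `A, B, C, D`, in lexicographic order. -/
def wordsOfLength : ℕ → List (List Color)
  | 0 => [[]]
  | k + 1 => [Color.A, Color.B, Color.C, Color.D].flatMap fun c =>
      ((wordsOfLength k).filter fun w => w.head? ≠ some c).map fun w => c :: w

/-- The `n`-th word (`n ≥ 1`) in the list `A, B, C, D, AB, AC, AD, BA, …` of the nontrivial reduced
words, ordered by length and then lexicographically. -/
def word (n : ℕ) : List Color :=
  (((List.range n).flatMap fun k => wordsOfLength (k + 1))[n - 1]?).getD []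

/-- The word that is used in step `n` of the construction: the first word in step `2`, the `n`-th
word in step `n ≥ 3`. -/
def stepWord (n : ℕ) : List Color := if n = 2 then word 1 else word n

/-- The colors, in this order, of the path that is attached in step `n`, beginning with the edge
that attaches it. If the word is `w_k ⋯ w_1`, these are `w_1, …, w_k` if `w_1 = D`, and
`D, w_1, …, w_k` if `w_1 ≠ D`. -/
def pathColors (n : ℕ) : List Color :=
  if (stepWord n).reverse.head? = some Color.D then (stepWord n).reverse
  else Color.D :: (stepWord n).reverse

lemma isChain_of_mem_wordsOfLength {k : ℕ} {w : List Color} (h : w ∈ wordsOfLength k) :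
    w.IsChain (· ≠ ·) := by
  induction k generalizing w with
  | zero => simp [wordsOfLength] at h; simp [h]
  | succ k ih =>
    simp only [wordsOfLength, List.mem_flatMap, List.mem_map, List.mem_filter] at h
    obtain ⟨c, -, v, ⟨hv, hc⟩, rfl⟩ := h
    rw [List.isChain_cons]
    refine ⟨fun y hy hcy => ?_, ih hv⟩
    subst hcy
    simp at hc
    exact hc hy

lemma isChain_word (n : ℕ) : (word n).IsChain (· ≠ ·) := by
  rw [word]
  cases h : ((List.range n).flatMap fun k => wordsOfLength (k + 1))[n - 1]? with
  | none => simp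
  | some w =>
    have := List.mem_of_getElem? h
    simp only [List.mem_flatMap] at this
    obtain ⟨k, -, hk⟩ := this
    exact isChain_of_mem_wordsOfLength hk

lemma isChain_pathColors (n : ℕ) : (pathColors n).IsChain (· ≠ ·) := by
  have h1 : (stepWord n).IsChain (· ≠ ·) := by
    rw [stepWord]; split_ifs <;> exact isChain_word _
  have h2 : (stepWord n).reverse.IsChain (· ≠ ·) := by
    rw [List.isChain_reverse]
    exact h1.imp fun _ _ h => h.symm
  rw [pathColors]
  split_ifs with h
  · exact h2
  · rw [List.isChain_cons]
    refine ⟨fun y hy hcy => h ?_, h2⟩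
    subst hcy
    exact hy

lemma pathColors_zero (n : ℕ) : (pathColors n)[0]? = some Color.D := by
  rw [pathColors]
  split_ifs with h
  · rw [← List.head?_eq_getElem?]; exact h
  · simp

lemma pathColors_succ_ne {n j : ℕ} {c : Color} (h : (pathColors n)[j]? = some c)
    (h' : (pathColors n)[j + 1]? = some c) : False := by
  obtain ⟨hj, h1⟩ := List.getElem?_eq_some_iff.1 h
  obtain ⟨hj', h2⟩ := List.getElem?_eq_some_iff.1 h'
  exact List.isChain_iff_getElem.1 (isChain_pathColors n) j hj' (h1.trans h2.symm)

/-! ### The graph that is glued from the pieces `H_n` -/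

/-- The choices that are made in the steps `n = 1, 2, …` of the construction: the graph `H_n` on the
vertex set `W n`, the partition of `W n` into the sets `R^n_i = {w | cls n w = i}` (for `n ≥ 2`),
the vertex `q n` at which `G_{n-1}` is attached to `H_n`, the vertex `x n` to which the path is
attached (for `n ≥ 2`), and the vertex `r n`. The data with index `n = 0`, and `cls 1` and `x 1`,
are not used. -/
structure GluingData where
  W : ℕ → Type
  finite_W : ∀ n, Finite (W n)
  H : ∀ n, ColoredGraph (W n)
  cls : ∀ n, W n → ℕ
  q : ∀ n, W n
  x : ∀ n, W n
  r : ∀ n, W n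
  not_D : ∀ n u v, ¬ (H n).edge Color.D u v
  r_one_ne_q_one : r 1 ≠ q 1
  cls_q : ∀ n, 2 ≤ n → cls n (q n) = n
  cls_x : ∀ n, 2 ≤ n → cls n (x n) = n + 1
  cls_r : ∀ n, 2 ≤ n → cls n (r n) = n + 1
  r_ne_x : ∀ n, 2 ≤ n → r n ≠ x n

namespace GluingData

variable (K : GluingData)

/-- Names for the vertices: the vertex `p` of `G_0`; the vertices of `H_n`; the vertex `v` of the
copy of a graph `G_{i-1}` that is attached to the vertex `u ∈ R^n_i` of `H_n`; the `j`-th vertex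
(`j = 0, 1, …`) of the path that is attached to `H_n`. -/
inductive Vertex : Type
  | base : Vertex
  | main (n : ℕ) (w : K.W n) : Vertex
  | copy (n : ℕ) (u : K.W n) (v : Vertex) : Vertex
  | path (n j : ℕ) : Vertex

variable {K} in
/-- The step in which a vertex is created. -/
def Vertex.level : K.Vertex → ℕ
  | .base => 0
  | .main n _ => n
  | .copy n _ _ => n
  | .path n _ => n

variable {K} in
/-- The names that do occur. Copies of `G_{i-1}` are attached to the vertices of `R^n_i` for
`1 ≤ i ≤ n - 1`; the vertices of `G_{i-1}` are those of level less than `i`. -/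
def Vertex.Valid : K.Vertex → Prop
  | .base => True
  | .main n _ => 1 ≤ n
  | .copy n u v => v.Valid ∧ v.level < K.cls n u ∧ K.cls n u < n
  | .path n j => 2 ≤ n ∧ j < (pathColors n).length

/-- The vertex `r_n` of `G_n`, with `r_0 = p`. -/
def root : ℕ → K.Vertex
  | 0 => .base
  | n + 1 => .main (n + 1) (K.r (n + 1))

/-- The edges, each in one direction. -/
inductive Link : Color → K.Vertex → K.Vertex → Prop
  /-- the edges of `H_n` -/
  | main {n : ℕ} {c : Color} {w w' : K.W n} (h : (K.H n).edge c w w') :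
      Link c (.main n w) (.main n w')
  /-- `G_n` is connected, at `r_n`, to the vertex `q_{n+1}` of `H_{n+1}` -/
  | glue {n : ℕ} {v : K.Vertex} (h : v = K.root n) :
      Link Color.D v (.main (n + 1) (K.q (n + 1)))
  /-- a copy of `G_{i-1}` is connected, at `r_{i-1}`, to each vertex `u ∈ R^n_i`, `1 ≤ i ≤ n-1` -/
  | attach {n : ℕ} {u : K.W n} {v : K.Vertex} (h1 : 1 ≤ K.cls n u) (h2 : K.cls n u < n)
      (h : v = K.root (K.cls n u - 1)) :
      Link Color.D (.main n u) (.copy n u v)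
  /-- the edges of the copy of `G_{i-1}` are those of `G_{i-1}` -/
  | copy {n : ℕ} {c : Color} {u : K.W n} {v v' : K.Vertex} (h : Link c v v')
      (h1 : v.level < K.cls n u) (h2 : v'.level < K.cls n u) :
      Link c (.copy n u v) (.copy n u v')
  /-- the path is attached to `x_n` -/
  | pathStart {n : ℕ} (h : 2 ≤ n) : Link Color.D (.main n (K.x n)) (.path n 0)
  /-- the edges of the path -/
  | pathStep {n j : ℕ} {c : Color} (h : (pathColors n)[j + 1]? = some c) :
      Link c (.path n j) (.path n (j + 1))

/-- The edges, in both directions. -/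
def Edge (c : Color) (v w : K.Vertex) : Prop := K.Link c v w ∨ K.Link c w v

lemma edge_base {c : Color} {y : K.Vertex} (h : K.Edge c .base y) :
    c = Color.D ∧ y = .main 1 (K.q 1) := by
  rcases h with h | h
  · cases h with
    | @glue n _ h =>
      cases n with
      | zero => exact ⟨rfl, rfl⟩
      | succ n => simp [root] at h
  · cases h

lemma edge_main {c : Color} {n : ℕ} {w : K.W n} {y : K.Vertex} (h : K.Edge c (.main n w) y) :
    (∃ w', (K.H n).edge c w w' ∧ y = .main n w') ∨
    c = Color.D ∧ ((1 ≤ n ∧ w = K.r n ∧ y = .main (n + 1) (K.q (n + 1))) ∨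
      (1 ≤ n ∧ w = K.q n ∧ y = K.root (n - 1)) ∨
      (1 ≤ K.cls n w ∧ K.cls n w < n ∧ y = .copy n w (K.root (K.cls n w - 1))) ∨
      (2 ≤ n ∧ w = K.x n ∧ y = .path n 0)) := by
  rcases h with h | h
  · cases h with
    | main h => exact Or.inl ⟨_, h, rfl⟩
    | @glue k _ h =>
      cases k with
      | zero => simp [root] at h
      | succ k =>
        simp only [root, Vertex.main.injEq] at h
        obtain ⟨rfl, h⟩ := h
        exact Or.inr ⟨rfl, Or.inl ⟨by omega, eq_of_heq h, rfl⟩⟩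
    | attach h1 h2 h => exact Or.inr ⟨rfl, Or.inr (Or.inr (Or.inl ⟨h1, h2, by rw [h]⟩))⟩
    | pathStart h => exact Or.inr ⟨rfl, Or.inr (Or.inr (Or.inr ⟨h, rfl, rfl⟩))⟩
  · cases h with
    | main h => exact Or.inl ⟨_, (K.H n).symm h, rfl⟩
    | glue h => exact Or.inr ⟨rfl, Or.inr (Or.inl ⟨by omega, rfl, by simpa using h⟩)⟩

lemma edge_copy {c : Color} {n : ℕ} {u : K.W n} {v y : K.Vertex} (h : K.Edge c (.copy n u v) y) :
    (∃ v', K.Edge c v v' ∧ v.level < K.cls n u ∧ v'.level < K.cls n u ∧ y = .copy n u v') ∨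
    (c = Color.D ∧ 1 ≤ K.cls n u ∧ K.cls n u < n ∧ v = K.root (K.cls n u - 1) ∧
      y = .main n u) := by
  rcases h with h | h
  · cases h with
    | @glue k _ h => cases k <;> simp [root] at h
    | copy h h1 h2 => exact Or.inl ⟨_, Or.inl h, h1, h2, rfl⟩
  · cases h with
    | attach h1 h2 h => exact Or.inr ⟨rfl, h1, h2, h, rfl⟩
    | copy h h1 h2 => exact Or.inl ⟨_, Or.inr h, h2, h1, rfl⟩

/-- The predecessor of the `j`-th vertex of the path that is attached in step `n`. -/
def pathPrev (n : ℕ) : ℕ → K.Vertex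
  | 0 => .main n (K.x n)
  | j + 1 => .path n j

lemma edge_path {c : Color} {n j : ℕ} {y : K.Vertex} (h : K.Edge c (.path n j) y) :
    (y = .path n (j + 1) ∧ (pathColors n)[j + 1]? = some c) ∨
    ((pathColors n)[j]? = some c ∧
      y = K.pathPrev n j) := by
  rcases h with h | h
  · cases h with
    | @glue k _ h => cases k <;> simp [root] at h
    | pathStep h => exact Or.inl ⟨rfl, h⟩
  · cases h with
    | pathStart h => exact Or.inr ⟨pathColors_zero n, rfl⟩
    | pathStep h => exact Or.inr ⟨h, rfl⟩

lemma Vertex.level_root (n : ℕ) : (K.root n).level = n := by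
  cases n <;> rfl

lemma r_ne_q {n : ℕ} (hn : 1 ≤ n) : K.r n ≠ K.q n := by
  intro h
  rcases Nat.lt_or_ge n 2 with h2 | h2
  · obtain rfl : n = 1 := by omega
    exact K.r_one_ne_q_one h
  · have h1 := K.cls_r n h2
    rw [h, K.cls_q n h2] at h1
    omega

lemma cls_r_not_lt {n : ℕ} (h1 : 1 ≤ K.cls n (K.r n)) (h : K.cls n (K.r n) < n) : False := by
  have := K.cls_r n (by omega)
  omega

lemma cls_q_not_lt {n : ℕ} (h1 : 1 ≤ K.cls n (K.q n)) (h : K.cls n (K.q n) < n) : False := by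
  have := K.cls_q n (by omega)
  omega

lemma cls_x_not_lt {n : ℕ} (h1 : 1 ≤ K.cls n (K.x n)) (h : K.cls n (K.x n) < n) : False := by
  have := K.cls_x n (by omega)
  omega

lemma q_ne_x {n : ℕ} (hn : 2 ≤ n) : K.q n ≠ K.x n := by
  intro h
  have h1 := K.cls_q n hn
  rw [h, K.cls_x n hn] at h1
  omega

/-- In `G_n` the vertex `r_n` has no edge of color `D`. -/
lemma edge_root {n : ℕ} {y : K.Vertex} (h : K.Edge Color.D (K.root n) y) :
    y = .main (n + 1) (K.q (n + 1)) := by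
  cases n with
  | zero => exact (K.edge_base h).2
  | succ n =>
    rcases K.edge_main h with ⟨w', hw, -⟩ | ⟨-, ⟨-, -, h⟩ | ⟨-, h, -⟩ | ⟨h1, h2, -⟩ | ⟨h2, h, -⟩⟩
    · exact (K.not_D _ _ _ hw).elim
    · exact h
    · exact (K.r_ne_q (by omega) h).elim
    · exact (K.cls_r_not_lt h1 h2).elim
    · exact (K.r_ne_x _ h2 h).elim

lemma edge_proper {c : Color} {v y z : K.Vertex} (hy : K.Edge c v y) (hz : K.Edge c v z) :
    y = z := by
  induction v generalizing y z with
  | base => rw [(K.edge_base hy).2, (K.edge_base hz).2]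
  | main n w =>
    rcases K.edge_main hy with ⟨w1, hw1, rfl⟩ | ⟨rfl, hy1⟩
    · rcases K.edge_main hz with ⟨w2, hw2, rfl⟩ | ⟨rfl, -⟩
      · rw [(K.H n).proper hw1 hw2]
      · exact (K.not_D _ _ _ hw1).elim
    · rcases K.edge_main hz with ⟨w2, hw2, rfl⟩ | ⟨-, hz1⟩
      · exact (K.not_D _ _ _ hw2).elim
      · rcases hy1 with ⟨h1, e1, rfl⟩ | ⟨h1, e1, rfl⟩ | ⟨h1, h1', rfl⟩ | ⟨h1, e1, rfl⟩ <;>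
        rcases hz1 with ⟨h2, e2, rfl⟩ | ⟨h2, e2, rfl⟩ | ⟨h2, h2', rfl⟩ | ⟨h2, e2, rfl⟩ <;>
        first
        | rfl
        | (exfalso; subst e1; exact K.r_ne_q h1 e2)
        | (exfalso; subst e1; exact K.r_ne_q h1 e2.symm)
        | (exfalso; subst e1; exact K.r_ne_x _ h2 e2)
        | (exfalso; subst e1; exact K.r_ne_x _ h1 e2.symm)
        | (exfalso; subst e1; exact K.q_ne_x h2 e2)
        | (exfalso; subst e1; exact K.q_ne_x h1 e2.symm)
        | (exfalso; subst e1; exact K.cls_r_not_lt h2 h2')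
        | (exfalso; subst e1; exact K.cls_q_not_lt h2 h2')
        | (exfalso; subst e1; exact K.cls_x_not_lt h2 h2')
        | (exfalso; subst e2; exact K.cls_r_not_lt h1 h1')
        | (exfalso; subst e2; exact K.cls_q_not_lt h1 h1')
        | (exfalso; subst e2; exact K.cls_x_not_lt h1 h1')
  | copy n u v ih =>
    rcases K.edge_copy hy with ⟨v1, e1, h1, h1', rfl⟩ | ⟨rfl, h1, h1', e1, rfl⟩
    · rcases K.edge_copy hz with ⟨v2, e2, h2, h2', rfl⟩ | ⟨rfl, h2, h2', rfl, rfl⟩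
      · rw [ih e1 e2]
      · rw [K.edge_root e1] at h1'
        simp only [Vertex.level] at h1'
        omega
    · rcases K.edge_copy hz with ⟨v2, e2, h2, h2', rfl⟩ | ⟨-, h2, h2', -, rfl⟩
      · rw [e1] at e2
        rw [K.edge_root e2] at h2'
        simp only [Vertex.level] at h2'
        omega
      · rfl
  | path n j =>
    rcases K.edge_path hy with ⟨rfl, h1⟩ | ⟨h1, rfl⟩ <;>
    rcases K.edge_path hz with ⟨rfl, h2⟩ | ⟨h2, rfl⟩
    · rfl
    · exact (pathColors_succ_ne h2 h1).elim
    · exact (pathColors_succ_ne h1 h2).elim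
    · rfl

lemma edge_irrefl {c : Color} {v : K.Vertex} (h : K.Edge c v v) : False := by
  induction v generalizing c with
  | base => simpa using (K.edge_base h).2
  | main n w =>
    rcases K.edge_main h with ⟨w', h1, h2⟩ | ⟨-, ⟨-, -, h⟩ | ⟨h1, -, h⟩ | ⟨-, -, h⟩ | ⟨-, -, h⟩⟩
    · simp only [Vertex.main.injEq, heq_eq_eq, true_and] at h2
      subst h2
      exact (K.H n).irrefl h1
    · have := congrArg Vertex.level h
      simp [Vertex.level] at this
    · have := congrArg Vertex.level h
      rw [Vertex.level_root] at this
      simp only [Vertex.level] at this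
      omega
    · cases h
    · cases h
  | copy n u v ih =>
    rcases K.edge_copy h with ⟨v1, e1, h1, h1', h⟩ | ⟨rfl, h1, h1', e1, h⟩
    · simp only [Vertex.copy.injEq, heq_eq_eq, true_and] at h
      subst h
      exact ih e1
    · cases h
  | path n j =>
    rcases K.edge_path h with ⟨h, -⟩ | ⟨-, h⟩
    · simp at h
    · cases j <;> simp [pathPrev] at h

lemma edge_color_unique {c c' : Color} {v y : K.Vertex} (h : K.Edge c v y)
    (h' : K.Edge c' v y) : c = c' := by
  induction v generalizing c c' y with
  | base => rw [(K.edge_base h).1, (K.edge_base h').1]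
  | main n w =>
    have key : ∀ {c c' : Color} {w' : K.W n}, (K.H n).edge c w w' →
        K.Edge c' (.main n w) (.main n w') → c = c' := by
      intro c c' w' h1 h2
      rcases K.edge_main h2 with ⟨w1, hw1, e⟩ | ⟨rfl, ⟨-, -, h⟩ | ⟨h1, -, h⟩ | ⟨-, -, h⟩ | ⟨-, -, h⟩⟩
      · simp only [Vertex.main.injEq, heq_eq_eq, true_and] at e
        subst e
        exact (K.H n).color_unique h1 hw1
      · have := congrArg Vertex.level h
        simp [Vertex.level] at this
      · have := congrArg Vertex.level h
        rw [Vertex.level_root] at this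
        simp only [Vertex.level] at this
        omega
      · cases h
      · cases h
    rcases K.edge_main h with ⟨w1, hw1, rfl⟩ | ⟨rfl, -⟩
    · exact key hw1 h'
    · rcases K.edge_main h' with ⟨w1, hw1, rfl⟩ | ⟨rfl, -⟩
      · exact (key hw1 h).symm
      · rfl
  | copy n u v ih =>
    rcases K.edge_copy h with ⟨v1, e1, -, -, rfl⟩ | ⟨rfl, -, -, -, rfl⟩
    · rcases K.edge_copy h' with ⟨v2, e2, -, -, h⟩ | ⟨-, -, -, -, h⟩
      · simp only [Vertex.copy.injEq, heq_eq_eq, true_and] at h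
        subst h
        exact ih e1 e2
      · cases h
    · rcases K.edge_copy h' with ⟨v2, e2, -, -, h⟩ | ⟨h, -⟩
      · cases h
      · exact h.symm
  | path n j =>
    rcases K.edge_path h with ⟨rfl, h1⟩ | ⟨h1, rfl⟩ <;>
    rcases K.edge_path h' with ⟨h, h2⟩ | ⟨h2, h⟩
    · exact Option.some.inj (h1.symm.trans h2)
    · cases j <;> simp [pathPrev] at h
      omega
    · cases j <;> simp [pathPrev] at h
      omega
    · exact Option.some.inj (h1.symm.trans h2)

/-- The vertex set of `G`. -/
def Vert : Type := {v : K.Vertex // v.Valid}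

/-- The colored graph `G = ⋃ G_n`. -/
def graph : ColoredGraph K.Vert where
  edge c v w := K.Edge c v.1 w.1
  symm h := h.symm
  irrefl h := K.edge_irrefl h
  color_unique h h' := K.edge_color_unique h h'
  proper h h' := Subtype.ext (K.edge_proper h h')

lemma finite_stage (n : ℕ) : {v : K.Vert | v.1.level ≤ n}.Finite := by
  have key : ∀ n, {v : K.Vertex | v.Valid ∧ v.level ≤ n}.Finite := by
    intro n
    induction n using Nat.strong_induction_on with
    | _ n ih =>
      have hsub : {v : K.Vertex | v.Valid ∧ v.level ≤ n} ⊆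
          {.base} ∪ (⋃ k ∈ Set.Iic n, (range (Vertex.main (K := K) k) ∪
            ((fun j => Vertex.path (K := K) k j) '' Set.Iio (pathColors k).length) ∪
            ⋃ u : K.W k, (Vertex.copy k u) ''
              {v | k - 1 < n ∧ v.Valid ∧ v.level ≤ k - 1})) := by
        rintro v ⟨hv, hl⟩
        cases v with
        | base => simp
        | main k w =>
          exact Or.inr (mem_biUnion (x := k) hl (Or.inl (Or.inl ⟨w, rfl⟩)))
        | path k j =>
          exact Or.inr (mem_biUnion (x := k) hl (Or.inl (Or.inr ⟨j, hv.2, rfl⟩)))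
        | copy k u v =>
          have hl' : k ≤ n := hl
          obtain ⟨h1, h2, h3⟩ := hv
          exact Or.inr (mem_biUnion (x := k) hl (Or.inr (mem_iUnion.2
            ⟨u, v, ⟨by omega, h1, by omega⟩, rfl⟩)))
      refine Set.Finite.subset ?_ hsub
      refine (finite_singleton _).union ((finite_Iic n).biUnion fun k _ => ?_)
      have := K.finite_W k
      refine ((finite_range _).union ((finite_Iio _).image _)).union
        (finite_iUnion fun u => Set.Finite.image _ ?_)
      by_cases hk : k - 1 < n
      · exact (ih (k - 1) hk).subset fun v hv => hv.2
      · exact Set.Finite.subset finite_empty fun v hv => hk hv.1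
  exact (key n).preimage (f := Subtype.val) Subtype.val_injective.injOn |>.subset
    fun v hv => ⟨v.2, hv⟩

/-- The vertex set of `G_n`. -/
def stage (n : ℕ) : Finset K.Vert := (K.finite_stage n).toFinset

open Classical in
/-- `Ω_n = V(G_n) \ V(G_{n-1})`. -/
def Omega (n : ℕ) : Finset K.Vert := K.stage n \ K.stage (n - 1)

/-- `s_n = m^n 2^{|V(G_{n-1})|}`. -/
def s (m n : ℕ) : ℕ := m ^ n * 2 ^ (K.stage (n - 1)).card

/-- The measure `μ_1` on the type space of `G`, obtained by averaging along the sets `Ω_{2n}`. -/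
def mu1 (ω : Ultrafilter ℕ) : Measure K.graph.TypeSpace :=
  K.graph.averageMeasure ω fun n => K.Omega (2 * n)

end GluingData

/-! ### The main construction -/

/-- `G` is isomorphic to the colored graph with the edges `R`. -/
def ColoredGraph.IsoTo {V T : Type*} (G : ColoredGraph V) (R : Color → T → T → Prop) : Prop :=
  ∃ e : V ≃ T, ∀ c u v, G.edge c u v ↔ R c (e u) (e v)

/-- The triangle with edges of the colors `A`, `B`, `C`. -/
def triangleEdge : Color → Fin 3 → Fin 3 → Prop
  | .A, u, v => (u = 0 ∧ v = 1) ∨ (u = 1 ∧ v = 0)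
  | .B, u, v => (u = 1 ∧ v = 2) ∨ (u = 2 ∧ v = 1)
  | .C, u, v => (u = 2 ∧ v = 0) ∨ (u = 0 ∧ v = 2)
  | .D, _, _ => False

/-- The cycle `C_i` of length `2i`, with edges that are colored alternately by `A` and `B`. -/
def cycleEdge (i : ℕ) : Color → ZMod (2 * i) → ZMod (2 * i) → Prop
  | .A, u, v => ∃ k : ZMod (2 * i), (u = 2 * k ∧ v = 2 * k + 1) ∨ (v = 2 * k ∧ u = 2 * k + 1)
  | .B, u, v => ∃ k : ZMod (2 * i),
      (u = 2 * k + 1 ∧ v = 2 * k + 2) ∨ (v = 2 * k + 1 ∧ u = 2 * k + 2)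
  | .C, _, _ => False
  | .D, _, _ => False

/-- The Cayley graph of the quotient of the group generated by `A, B, C` by a subgroup `N`. -/
def cayleyEdge (N : Subgroup GamTilde) (c : Color) (u v : GamTilde ⧸ N) : Prop :=
  c ≠ Color.D ∧ u ≠ v ∧ ∃ g : GamTilde, (g : Gam) = gen c ∧ v = g • u

/-- The conditions on the choices in the main construction with parameter `m`, where
`N` is the chain of normal subgroups that defines the Cayley graphs `K_i`. -/
structure IsMainConstruction (N : ℕ → Subgroup GamTilde) (m : ℕ) (K : GluingData) : Prop where
  H_one : (K.H 1).IsoTo triangleEdge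
  H_even : ∀ n, 2 ≤ n → Even n → ∃ i, 1 ≤ i ∧ (K.H n).IsoTo (cycleEdge i)
  H_odd : ∀ n, 2 ≤ n → Odd n → ∃ i, (K.H n).IsoTo (cayleyEdge (N i))
  le_diam : ∀ n, 2 ≤ n → 10 * K.s m n ≤ (K.H n).toSimpleGraph.diam
  cls_mem : ∀ n, 2 ≤ n → ∀ w, 1 ≤ K.cls n w ∧ K.cls n w ≤ n + 1
  /-- `R^n_i` is a `2 s_i`-net -/
  net : ∀ n, 2 ≤ n → ∀ i, 1 ≤ i → i ≤ n → ∀ u v, K.cls n u = i → K.cls n v = i → u ≠ v →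
    2 * K.s m i ≤ (K.H n).toSimpleGraph.dist u v
  /-- every vertex has distance at most `10 s_i` to `R^n_i` -/
  cover : ∀ n, 2 ≤ n → ∀ i, 1 ≤ i → i ≤ n → ∀ u, ∃ p, K.cls n p = i ∧
    (K.H n).toSimpleGraph.dist p u ≤ 10 * K.s m i

end TypeSpaceAction

end

namespace TypeSpaceAction

namespace ColoredGraph

variable {V : Type*} (G : ColoredGraph V)

/-! ### Sets of chains that are determined by finitely many types -/

/-! Everything is counted in Ω_n with n even, where H_n is a long cycle, of length 2i ≤ |Ω_n|.
Points of R_j are at least 2s_j apart, so |R_j| · 2s_j ≤ 2i. As s_j = m^j 2^{|V(G_{j-1})|}, the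
points of R_j and the copies of G_{j-1} attached to them number at most 2i/(2m^j); the sum over 1 ≤
j < n is at most 2i/m (`mul_sum_copies_le`). The path has at most n + 1 vertices, and m(n + 3) ≤ 2i
(`mul_length_le`).

Upper bound. A vertex of Ω_n with three neighbors lies in a copy, or is a point of the cycle that
carries an edge of color D. So at most the fraction 2/m of Ω_n has three neighbors
(`mul_card_threeSteps_le`). A chain with more than two neighbors has three neighbors that are told
apart by their r-types for some r. For fixed r this is a condition on the (r+1)-type, and a vertex
that satisfies it has three neighbors in G. Hence its measure is at most 2/m, uniformly in r, and
continuity from below gives the first claim. Since degrees in the graphing are at most 4, also e ≤ 1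
+ 2/m.

Lower bound. It remains to see that, at one level r independent of n, most vertices differ in type
from their A- and B-neighbors and these differ from each other. The copies of G_0 at the points of
R_1 are leaves, found within distance 10s_1 of every point of the cycle. The colors A and B
alternate, so equal types at z and z + 1 make the set of leaves symmetric, near z, under the
reflection that exchanges z and z + 1. Equal types at z - 1 and z + 1 make it locally invariant
under translation by 2, which the spacing of R_1 forbids. There are at most as many local reflection
centers as leaves (`card_reflections_le`), and at most |R_1| + 1 leaves, a small fraction of the
cycle. This yields e ≥ 1 - 3/m. -/

lemma exists_types_eq (r : ℕ) (a : G.TypeSpace) : ∃ x, a.types r = (G.toTypeSpace x).types r := by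
  obtain ⟨x, hx⟩ := Quotient.exists_rep (a.types r)
  exact ⟨x, hx.symm⟩

lemma types_eq_of_le {r s : ℕ} (h : r ≤ s) {a b : G.TypeSpace} (hab : a.types s = b.types s) :
    a.types r = b.types r := by
  obtain ⟨x, hx⟩ := G.exists_types_eq s b
  rw [TypeSpace.eq_of_eq G h (hab.trans hx), TypeSpace.eq_of_eq G h hx]

lemma exists_types_ne {a b : G.TypeSpace} (h : a ≠ b) : ∃ r, a.types r ≠ b.types r := by
  by_contra! hab
  exact h (G.isEmbedding_types.injective (funext hab))

/-- Equivariance of π: conditions on neighbors in the type space become, for chains of vertices,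
conditions on neighbors in `G`. -/
lemma spaceStep_toTypeSpace (c : Color) (v : V) :
    G.spaceStep c (G.toTypeSpace v) = G.toTypeSpace (G.step c v) :=
  G.isEmbedding_types.injective (funext fun _ => G.spaceStep_apply rfl)

lemma spaceStep_types_eq (c : Color) {r : ℕ} {a b : G.TypeSpace}
    (h : a.types (r + 1) = b.types (r + 1)) :
    (G.spaceStep c a).types r = (G.spaceStep c b).types r :=
  congrArg (G.typeStep c r) h

/-- Membership in `U` depends only on the `r`-th term of a chain. -/
def DependsOn (r : ℕ) (U : Set G.TypeSpace) : Prop :=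
  ∀ a b : G.TypeSpace, a.types r = b.types r → a ∈ U → b ∈ U

variable {G}

lemma DependsOn.eq_biUnion {r : ℕ} {U : Set G.TypeSpace} (hU : G.DependsOn r U) :
    U = ⋃ α ∈ {α | ∃ x, G.toTypeSpace x ∈ U ∧ G.rtype r x = α}, G.cylinder r α := by
  ext a
  simp only [mem_ofPred_eq, mem_iUnion, cylinder, exists_prop]
  constructor
  · intro ha
    obtain ⟨x, hx⟩ := G.exists_types_eq r a
    exact ⟨_, ⟨x, hU _ _ hx ha, rfl⟩, hx⟩
  · rintro ⟨_, ⟨x, hx, rfl⟩, ha⟩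
    exact hU _ _ ha.symm hx

lemma DependsOn.isOpen {r : ℕ} {U : Set G.TypeSpace} (hU : G.DependsOn r U) : IsOpen U := by
  rw [hU.eq_biUnion]
  exact isOpen_biUnion fun α _ => (G.isClopen_cylinder r α).isOpen

lemma DependsOn.compl {r : ℕ} {U : Set G.TypeSpace} (hU : G.DependsOn r U) :
    G.DependsOn r Uᶜ :=
  fun a b hab ha hb => ha (hU b a hab.symm hb)

open Classical in
-- There are only finitely many `r`-types, so `U` is a finite disjoint union of cylinders, and the
-- limits that define the measure on cylinders add up.
lemma DependsOn.tendsto {r : ℕ} {U : Set G.TypeSpace} (hU : G.DependsOn r U)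
    (ω : Ultrafilter ℕ) (F : ℕ → Finset V) :
    Tendsto (fun n => (((F n).filter fun v => G.toTypeSpace v ∈ U).card : ℝ≥0∞) /
      ((F n).card : ℝ≥0∞)) ω (𝓝 (G.averageMeasure ω F U)) := by
  set S := {α | ∃ x, G.toTypeSpace x ∈ U ∧ G.rtype r x = α} with hS
  have hfin : S.Finite := Set.toFinite S
  have hUS : U = ⋃ α ∈ hfin.toFinset, G.cylinder r α := by
    simp only [hfin.mem_toFinset]
    exact hU.eq_biUnion
  have hmem : ∀ v, G.toTypeSpace v ∈ U ↔ G.rtype r v ∈ hfin.toFinset := by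
    intro v
    conv_lhs => rw [hUS]
    simp [cylinder, toTypeSpace]
  have h1 : G.averageMeasure ω F U = ∑ α ∈ hfin.toFinset, G.averageMeasure ω F (G.cylinder r α) := by
    conv_lhs => rw [hUS]
    refine measure_biUnion_finset ?_ fun α _ => (G.isClopen_cylinder r α).isOpen.measurableSet
    intro α _ β _ hαβ
    rw [Function.onFun, Set.disjoint_left]
    exact fun a ha hb => hαβ (ha.symm.trans hb)
  rw [h1]
  refine (tendsto_finsetSum _ fun α _ => G.averageMeasure_cylinder ω F r α).congr fun n => ?_
  simp only [div_eq_mul_inv]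
  rw [← Finset.sum_mul]
  congr 1
  rw [Finset.card_eq_sum_card_fiberwise (f := G.rtype r) (t := hfin.toFinset)
    (fun v hv => (hmem v).1 (Finset.mem_filter.1 hv).2)]
  push_cast
  refine Finset.sum_congr rfl fun α hα => ?_
  congr 2
  ext v
  simp only [Finset.mem_filter, and_congr_left_iff]
  rintro rfl
  simp [(hmem v).2 hα]

open Classical in
lemma DependsOn.averageMeasure_le {r : ℕ} {U : Set G.TypeSpace} (hU : G.DependsOn r U)
    (ω : Ultrafilter ℕ) (F : ℕ → Finset V) {c : ℝ≥0∞}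
    (h : ∀ᶠ n in (ω : Filter ℕ), (((F n).filter fun v => G.toTypeSpace v ∈ U).card : ℝ≥0∞) ≤
      c * (F n).card) :
    G.averageMeasure ω F U ≤ c :=
  le_of_tendsto (hU.tendsto ω F) (h.mono fun _ hn => ENNReal.div_le_of_le_mul hn)

variable (G)

lemma averageMeasure_univ (ω : Ultrafilter ℕ) (F : ℕ → Finset V)
    (h : ∀ᶠ n in (ω : Filter ℕ), (F n).Nonempty) : G.averageMeasure ω F univ = 1 := by
  have hU : G.DependsOn 0 univ := fun _ _ _ _ => trivial
  refine tendsto_nhds_unique (hU.tendsto ω F) (tendsto_const_nhds.congr' (h.mono fun n hn => ?_))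
  simp only [mem_univ, Finset.filter_true]
  exact (ENNReal.div_self (by simpa using hn.ne_empty) (by simp)).symm

/-! ### Degrees in the graphing -/

/-- Generators act by involutions, so the two orientations in the definition of the Schreier graph
agree. -/
lemma mem_neighborSet_graphing {a b : G.TypeSpace} :
    b ∈ G.graphing.neighborSet a ↔ a ≠ b ∧ ∃ c, b = G.spaceStep c a := by
  simp only [SimpleGraph.mem_neighborSet, graphing, schreierGraph, SimpleGraph.fromRel_adj,
    spaceAction, actionOfInvolutions_gen, and_congr_right_iff]
  intro _
  constructor
  · rintro (⟨c, h⟩ | ⟨c, h⟩)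
    · exact ⟨c, by rw [h, G.spaceStep_involutive c b]⟩
    · exact ⟨c, h⟩
  · exact fun h => Or.inr h

lemma degree_graphing_le (a : G.TypeSpace) : degree G.graphing a ≤ 4 := by
  have hsub : G.graphing.neighborSet a ⊆ {G.spaceStep Color.A a, G.spaceStep Color.B a,
      G.spaceStep Color.C a, G.spaceStep Color.D a} := by
    intro b hb
    obtain ⟨-, c, rfl⟩ := (G.mem_neighborSet_graphing).1 hb
    cases c <;> simp
  refine (encard_le_encard hsub).trans ?_
  refine (encard_insert_le _ _).trans ?_
  refine (add_le_add_left ((encard_insert_le _ _).trans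
    (add_le_add_left (encard_insert_le _ _) 1)) 1).trans ?_
  rw [encard_singleton]
  norm_num

/-- The chains with three neighbors that are distinguished by their `r`-types. -/
def threeNeighbors (r : ℕ) : Set G.TypeSpace :=
  {a | ∃ c₁ c₂ c₃, (G.spaceStep c₁ a).types r ≠ a.types r ∧
    (G.spaceStep c₂ a).types r ≠ a.types r ∧ (G.spaceStep c₃ a).types r ≠ a.types r ∧
    (G.spaceStep c₁ a).types r ≠ (G.spaceStep c₂ a).types r ∧
    (G.spaceStep c₁ a).types r ≠ (G.spaceStep c₃ a).types r ∧
    (G.spaceStep c₂ a).types r ≠ (G.spaceStep c₃ a).types r}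

/-- Applying a generator costs one level: the `r`-types of all neighbors are read off from the
`(r+1)`-type. -/
lemma dependsOn_threeNeighbors (r : ℕ) : G.DependsOn (r + 1) (G.threeNeighbors r) := by
  rintro a b hab ⟨c₁, c₂, c₃, h⟩
  refine ⟨c₁, c₂, c₃, ?_⟩
  have h0 := G.types_eq_of_le (Nat.le_succ r) hab
  rwa [← G.spaceStep_types_eq c₁ hab, ← G.spaceStep_types_eq c₂ hab, ← G.spaceStep_types_eq c₃ hab,
    ← h0]

lemma monotone_threeNeighbors : Monotone G.threeNeighbors := by
  rintro r s hrs a ⟨c₁, c₂, c₃, h1, h2, h3, h4, h5, h6⟩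
  exact ⟨c₁, c₂, c₃, fun h => h1 (G.types_eq_of_le hrs h), fun h => h2 (G.types_eq_of_le hrs h),
    fun h => h3 (G.types_eq_of_le hrs h), fun h => h4 (G.types_eq_of_le hrs h),
    fun h => h5 (G.types_eq_of_le hrs h), fun h => h6 (G.types_eq_of_le hrs h)⟩

/-- Distinct chains differ at some finite level, and then at all later ones. Three neighbors require
six such separations, and a level beyond all six works. -/
lemma two_lt_degree_subset :
    {a | 2 < degree G.graphing a} ⊆ ⋃ r, G.threeNeighbors r := by
  intro a ha
  have hfin : (G.graphing.neighborSet a).Finite :=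
    finite_of_encard_le_coe (k := 4) (by exact_mod_cast G.degree_graphing_le a)
  have h3 : 2 < (G.graphing.neighborSet a).ncard := by
    have : (2 : ℕ∞) < (G.graphing.neighborSet a).encard := ha
    rw [← hfin.cast_ncard_eq] at this
    exact_mod_cast this
  obtain ⟨b₁, b₂, b₃, h1, h2, h3, h12, h13, h23⟩ := (two_lt_ncard_iff hfin).1 h3
  obtain ⟨n1, c₁, rfl⟩ := (G.mem_neighborSet_graphing).1 h1
  obtain ⟨n2, c₂, rfl⟩ := (G.mem_neighborSet_graphing).1 h2
  obtain ⟨n3, c₃, rfl⟩ := (G.mem_neighborSet_graphing).1 h3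
  obtain ⟨r1, e1⟩ := G.exists_types_ne n1.symm
  obtain ⟨r2, e2⟩ := G.exists_types_ne n2.symm
  obtain ⟨r3, e3⟩ := G.exists_types_ne n3.symm
  obtain ⟨r4, e4⟩ := G.exists_types_ne h12
  obtain ⟨r5, e5⟩ := G.exists_types_ne h13
  obtain ⟨r6, e6⟩ := G.exists_types_ne h23
  refine mem_iUnion.2 ⟨r1 + r2 + r3 + r4 + r5 + r6, c₁, c₂, c₃, ?_, ?_, ?_, ?_, ?_, ?_⟩
  · exact fun h => e1 (G.types_eq_of_le (by omega) h)
  · exact fun h => e2 (G.types_eq_of_le (by omega) h)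
  · exact fun h => e3 (G.types_eq_of_le (by omega) h)
  · exact fun h => e4 (G.types_eq_of_le (by omega) h)
  · exact fun h => e5 (G.types_eq_of_le (by omega) h)
  · exact fun h => e6 (G.types_eq_of_le (by omega) h)

/-- The vertices with at least three neighbors. -/
def ThreeSteps (v : V) : Prop :=
  ∃ c₁ c₂ c₃, G.step c₁ v ≠ v ∧ G.step c₂ v ≠ v ∧ G.step c₃ v ≠ v ∧
    G.step c₁ v ≠ G.step c₂ v ∧ G.step c₁ v ≠ G.step c₃ v ∧ G.step c₂ v ≠ G.step c₃ v

lemma threeSteps_of_mem {r : ℕ} {v : V} (h : G.toTypeSpace v ∈ G.threeNeighbors r) :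
    G.ThreeSteps v := by
  obtain ⟨c₁, c₂, c₃, h⟩ := h
  simp only [spaceStep_toTypeSpace] at h
  obtain ⟨h1, h2, h3, h4, h5, h6⟩ := h
  exact ⟨c₁, c₂, c₃, fun h => h1 (by rw [h]), fun h => h2 (by rw [h]), fun h => h3 (by rw [h]),
    fun h => h4 (by rw [h]), fun h => h5 (by rw [h]), fun h => h6 (by rw [h])⟩

open Classical in
-- The count of vertices with three neighbors does not involve `r`, so the bound holds for each set
-- of the increasing union and passes to its supremum.
lemma averageMeasure_iUnion_threeNeighbors_le (ω : Ultrafilter ℕ) (F : ℕ → Finset V) {c : ℝ≥0∞}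
    (h : ∀ᶠ n in (ω : Filter ℕ), (((F n).filter G.ThreeSteps).card : ℝ≥0∞) ≤ c * (F n).card) :
    G.averageMeasure ω F (⋃ r, G.threeNeighbors r) ≤ c := by
  rw [(G.monotone_threeNeighbors.directed_le).measure_iUnion]
  refine iSup_le fun r => (G.dependsOn_threeNeighbors r).averageMeasure_le ω F (h.mono fun n hn => ?_)
  refine le_trans ?_ hn
  exact_mod_cast Finset.card_le_card fun v hv => Finset.mem_filter.2
    ⟨(Finset.mem_filter.1 hv).1, G.threeSteps_of_mem (Finset.mem_filter.1 hv).2⟩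

/-! ### Bounds for the edge measure -/

/-- The chains whose `A`- and `B`-neighbors are distinguished by their `r`-types. -/
def twoNeighbors (r : ℕ) : Set G.TypeSpace :=
  {a | (G.spaceStep Color.A a).types r ≠ a.types r ∧
    (G.spaceStep Color.B a).types r ≠ a.types r ∧
    (G.spaceStep Color.A a).types r ≠ (G.spaceStep Color.B a).types r}

lemma dependsOn_twoNeighbors (r : ℕ) : G.DependsOn (r + 1) (G.twoNeighbors r) := by
  intro a b hab h
  have h0 := G.types_eq_of_le (Nat.le_succ r) hab
  change _ ∧ _ ∧ _ at h
  rw [G.spaceStep_types_eq _ hab, G.spaceStep_types_eq Color.B hab, h0] at h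
  exact h

lemma two_le_degree {r : ℕ} {a : G.TypeSpace} (h : a ∈ G.twoNeighbors r) :
    2 ≤ degree G.graphing a := by
  obtain ⟨h1, h2, h3⟩ := h
  have hne : G.spaceStep Color.A a ≠ G.spaceStep Color.B a := fun h => h3 (by rw [h])
  have hsub : {G.spaceStep Color.A a, G.spaceStep Color.B a} ⊆ G.graphing.neighborSet a := by
    rintro b (rfl | rfl)
    · exact (G.mem_neighborSet_graphing).2 ⟨fun h => h1 (by rw [← h]), _, rfl⟩
    · exact (G.mem_neighborSet_graphing).2 ⟨fun h => h2 (by rw [← h]), _, rfl⟩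
  calc (2 : ℕ∞) = ({G.spaceStep Color.A a, G.spaceStep Color.B a} : Set _).encard :=
        (encard_pair hne).symm
    _ ≤ _ := encard_le_encard hsub

open Classical in
/-- The edge measure is close to `1` if most vertices have at most two neighbors and most vertices
differ in their types from their `A`- and `B`-neighbors. -/
lemma edgeMeasure_bounds (ω : Ultrafilter ℕ) (F : ℕ → Finset V) {c d : ℝ≥0∞} {r : ℕ}
    (h0 : ∀ᶠ n in (ω : Filter ℕ), (F n).Nonempty)
    (hc : ∀ᶠ n in (ω : Filter ℕ), (((F n).filter G.ThreeSteps).card : ℝ≥0∞) ≤ c * (F n).card)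
    (hd : ∀ᶠ n in (ω : Filter ℕ), (((F n).filter fun v => ¬ G.toTypeSpace v ∈ G.twoNeighbors r).card
      : ℝ≥0∞) ≤ d * (F n).card) :
    1 - d ≤ edgeMeasure G.graphing (G.averageMeasure ω F) ∧
      edgeMeasure G.graphing (G.averageMeasure ω F) ≤ 1 + c := by
  set μ := G.averageMeasure ω F
  have hμ : μ univ = 1 := G.averageMeasure_univ ω F h0
  have half : (1 / 2 : ℝ≥0∞) * 2 = 1 := by
    rw [one_div]; exact ENNReal.inv_mul_cancel (by simp) (by simp)
  have hV := G.dependsOn_twoNeighbors r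
  have hVm : MeasurableSet (G.twoNeighbors r) := hV.isOpen.measurableSet
  have hT : MeasurableSet (⋃ r, G.threeNeighbors r) :=
    (isOpen_iUnion fun r => (G.dependsOn_threeNeighbors r).isOpen).measurableSet
  -- Both halves compare the degree with a measurable step function by monotonicity of the integral;
  -- measurability of the degree itself is not needed.
  constructor
  · have h1 : μ (G.twoNeighbors r)ᶜ ≤ d := hV.compl.averageMeasure_le ω F (by convert hd)
    have h2 : (1 : ℝ≥0∞) ≤ μ (G.twoNeighbors r) + d := by
      rw [← hμ, ← measure_add_measure_compl hVm]
      gcongr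
    refine (tsub_le_iff_right.2 h2).trans ?_
    have h3 : 2 * μ (G.twoNeighbors r) ≤ ∫⁻ a, (degree G.graphing a : ℝ≥0∞) ∂μ := by
      rw [← lintegral_indicator_const hVm]
      refine lintegral_mono fun a => ?_
      by_cases ha : a ∈ G.twoNeighbors r
      · rw [indicator_of_mem ha]
        simpa using ENat.toENNReal_le.2 (G.two_le_degree ha)
      · simp [indicator_of_notMem ha]
    calc μ (G.twoNeighbors r) = (1 / 2) * (2 * μ (G.twoNeighbors r)) := by
          rw [← mul_assoc, half, one_mul]
      _ ≤ _ := by unfold edgeMeasure; gcongr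
  · have h1 : μ (⋃ r, G.threeNeighbors r) ≤ c := G.averageMeasure_iUnion_threeNeighbors_le ω F hc
    have h3 : ∫⁻ a, (degree G.graphing a : ℝ≥0∞) ∂μ ≤ 2 + 2 * c := by
      calc ∫⁻ a, (degree G.graphing a : ℝ≥0∞) ∂μ
          ≤ ∫⁻ a, (2 + (⋃ r, G.threeNeighbors r).indicator (fun _ => (2 : ℝ≥0∞)) a) ∂μ := by
            refine lintegral_mono fun a => ?_
            -- On the union the degree is at most 4 = 2 + 2, off it at most 2.
            by_cases ha : a ∈ ⋃ r, G.threeNeighbors r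
            · simp only [indicator_of_mem ha]
              have := G.degree_graphing_le a
              have h4 : (degree G.graphing a : ℝ≥0∞) ≤ 4 := by exact_mod_cast this
              exact h4.trans (by norm_num)
            · have : ¬ 2 < degree G.graphing a := fun h => ha (G.two_lt_degree_subset h)
              simp only [indicator_of_notMem ha, add_zero]
              exact_mod_cast not_lt.1 this
        _ = 2 + 2 * μ (⋃ r, G.threeNeighbors r) := by
            rw [lintegral_add_left measurable_const, lintegral_const, hμ, mul_one,
              lintegral_indicator_const hT]
        _ ≤ _ := by gcongr
    calc edgeMeasure G.graphing μ ≤ (1 / 2) * (2 + 2 * c) := by unfold edgeMeasure; gcongr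
      _ = 1 + c := by rw [mul_add, ← mul_assoc, half, one_mul]

end ColoredGraph

end TypeSpaceAction

namespace TypeSpaceAction

/-! ### The cycle -/

/-- In the position `z` of the cycle, `c` is the color of the edge to `z + 1` and `c'` is the color
of the edge to `z - 1`. -/
def Up {i : ℕ} (c c' : Color) (z : ZMod (2 * i)) : Prop :=
  (c = Color.A ∧ c' = Color.B ∧ ∃ k, z = 2 * k) ∨
    (c = Color.B ∧ c' = Color.A ∧ ∃ k, z = 2 * k + 1)

section Cycle

variable {i : ℕ} {c c' : Color} {z : ZMod (2 * i)}

lemma exists_up [NeZero (2 * i)] (z : ZMod (2 * i)) : ∃ c c', Up c c' z := by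
  rcases Nat.even_or_odd' z.val with ⟨k, hk | hk⟩
  · refine ⟨_, _, Or.inl ⟨rfl, rfl, k, ?_⟩⟩
    rw [← ZMod.natCast_zmod_val z, hk]; push_cast; rfl
  · refine ⟨_, _, Or.inr ⟨rfl, rfl, k, ?_⟩⟩
    rw [← ZMod.natCast_zmod_val z, hk]; push_cast; rfl

lemma Up.succ (h : Up c c' z) : Up c' c (z + 1) := by
  rcases h with ⟨rfl, rfl, k, rfl⟩ | ⟨rfl, rfl, k, rfl⟩
  · exact Or.inr ⟨rfl, rfl, k, rfl⟩
  · exact Or.inl ⟨rfl, rfl, k + 1, by ring⟩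

lemma Up.pred (h : Up c c' z) : Up c' c (z - 1) := by
  rcases h with ⟨rfl, rfl, k, rfl⟩ | ⟨rfl, rfl, k, rfl⟩
  · exact Or.inr ⟨rfl, rfl, k - 1, by ring⟩
  · exact Or.inl ⟨rfl, rfl, k, by ring⟩

lemma Up.cycleEdge_succ (h : Up c c' z) : cycleEdge i c z (z + 1) := by
  rcases h with ⟨rfl, rfl, k, rfl⟩ | ⟨rfl, rfl, k, rfl⟩
  · exact ⟨k, Or.inl ⟨rfl, rfl⟩⟩
  · exact ⟨k, Or.inl ⟨rfl, by ring⟩⟩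

lemma Up.cycleEdge_pred (h : Up c c' z) : cycleEdge i c' z (z - 1) := by
  rcases h with ⟨rfl, rfl, k, rfl⟩ | ⟨rfl, rfl, k, rfl⟩
  · exact ⟨k - 1, Or.inr ⟨by ring, by ring⟩⟩
  · exact ⟨k, Or.inr ⟨by ring, rfl⟩⟩

lemma cycleEdge_cases {u v : ZMod (2 * i)} (h : cycleEdge i c u v) : v = u + 1 ∨ v = u - 1 := by
  cases c with
  | A =>
    rcases h with ⟨k, ⟨rfl, rfl⟩ | ⟨rfl, rfl⟩⟩
    · exact Or.inl rfl
    · exact Or.inr (by ring)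
  | B =>
    rcases h with ⟨k, ⟨rfl, rfl⟩ | ⟨rfl, rfl⟩⟩
    · exact Or.inl (by ring)
    · exact Or.inr (by ring)
  | C => exact h.elim
  | D => exact h.elim

lemma cycleEdge_color {u v : ZMod (2 * i)} (h : cycleEdge i c u v) : c = Color.A ∨ c = Color.B := by
  cases c with
  | A => exact Or.inl rfl
  | B => exact Or.inr rfl
  | C => exact h.elim
  | D => exact h.elim

variable {W : Type*} {H : ColoredGraph W} (e : W ≃ ZMod (2 * i))
  (he : ∀ c u v, H.edge c u v ↔ cycleEdge i c (e u) (e v))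

include he in
lemma cycle_edist_le [NeZero (2 * i)] (u : W) (k : ℕ) :
    H.toSimpleGraph.edist u (e.symm (e u + k)) ≤ k := by
  induction k with
  | zero => simp
  | succ k ih =>
    refine (SimpleGraph.edist_triangle (v := e.symm (e u + k))).trans ?_
    push_cast
    refine add_le_add ih (SimpleGraph.edist_le_one_iff_adj_or_eq.2 (Or.inl ?_))
    obtain ⟨c, c', h⟩ := exists_up (e u + (k : ZMod (2 * i)))
    refine ⟨c, (he _ _ _).2 ?_⟩
    simpa [add_assoc] using h.cycleEdge_succ

include he in
-- Going forward from `u` reaches `v` in fewer than `2 * i` steps. In particular the cycle is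
-- connected, so `dist` never takes its default value 0 for unreachable pairs.
lemma cycle_edist_lt [NeZero (2 * i)] (u v : W) : H.toSimpleGraph.edist u v < (2 * i : ℕ) := by
  have h := cycle_edist_le e he u (e v - e u).val
  rw [ZMod.natCast_zmod_val, add_sub_cancel, e.symm_apply_apply] at h
  exact h.trans_lt (by exact_mod_cast ZMod.val_lt _)

include he in
lemma cycle_diam_le [NeZero (2 * i)] : H.toSimpleGraph.diam ≤ 2 * i := by
  have h : H.toSimpleGraph.ediam ≤ (2 * i : ℕ) :=
    SimpleGraph.ediam_le_of_edist_le fun u v => (cycle_edist_lt e he u v).le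
  exact ENat.toNat_le_of_le_natCast h

include he in
lemma cycle_dist_le [NeZero (2 * i)] (u : W) (k : ℕ) :
    H.toSimpleGraph.dist u (e.symm (e u + k)) ≤ k :=
  ENat.toNat_le_of_le_natCast (cycle_edist_le e he u k)

include he in
-- Every edge changes the position by ±1, so the signed length of a geodesic is the required
-- displacement.
lemma cycle_exists_of_dist_le [NeZero (2 * i)] {u v : W} {k : ℕ}
    (h : H.toSimpleGraph.dist u v ≤ k) : ∃ t : ℤ, |t| ≤ k ∧ e v = e u + t := by
  have hr : H.toSimpleGraph.Reachable u v := by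
    rw [← SimpleGraph.edist_ne_top_iff_reachable]
    exact (cycle_edist_lt e he u v).ne_top
  obtain ⟨p, hp⟩ := hr.exists_walk_length_eq_dist
  have key : ∀ {a b : W} (p : H.toSimpleGraph.Walk a b),
      ∃ t : ℤ, |t| ≤ p.length ∧ e b = e a + t := by
    intro a b p
    induction p with
    | nil => exact ⟨0, by simp⟩
    | cons hadj p ih =>
      have hlen := SimpleGraph.Walk.length_cons hadj p
      have hc' := hadj
      obtain ⟨t, ht, hb⟩ := ih
      obtain ⟨c, hc⟩ := hc'
      rw [abs_le] at ht
      rcases cycleEdge_cases ((he _ _ _).1 hc) with h | h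
      · refine ⟨t + 1, ?_, by rw [hb, h]; push_cast; ring⟩
        rw [abs_le, hlen]; push_cast; constructor <;> linarith
      · refine ⟨t - 1, ?_, by rw [hb, h]; push_cast; ring⟩
        rw [abs_le, hlen]; push_cast; constructor <;> linarith
  obtain ⟨t, ht, htv⟩ := key p
  exact ⟨t, ht.trans (by exact_mod_cast hp ▸ h), htv⟩

include he in
/-- A set of points of the cycle at mutual distance at least `s` has at most `2i / s` points. -/
lemma cycle_card_mul_le [NeZero (2 * i)] {s : ℕ} (hs : s ≤ 2 * i) (R : Finset W)
    (hR : ∀ u ∈ R, ∀ v ∈ R, u ≠ v → s ≤ H.toSimpleGraph.dist u v) : R.card * s ≤ 2 * i := by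
  -- The arcs u, u + 1, …, u + s - 1 with u in `R` are disjoint: if two of them met, the start of
  -- one would lie fewer than `s` steps ahead of the other. The bound `s ≤ 2 * i` keeps a single arc
  -- from overlapping itself.
  have key : ∀ u ∈ R, ∀ v ∈ R, ∀ k l : ℕ, k < s → l ≤ k → e u + k = e v + l → u = v ∧ k = l := by
    intro u hu v hv k l hk hlk h
    have h1 : e v = e u + ((k - l : ℕ) : ZMod (2 * i)) := by
      rw [Nat.cast_sub hlk, ← add_sub_assoc, h]; ring
    have huv : u = v := by
      by_contra hne
      have h2 := cycle_dist_le e he u (k - l)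
      rw [← h1, e.symm_apply_apply] at h2
      have := hR u hu v hv hne
      omega
    subst huv
    refine ⟨rfl, ?_⟩
    have h2 : (k : ZMod (2 * i)) = l := add_left_cancel h
    rw [ZMod.natCast_eq_natCast_iff, Nat.ModEq, Nat.mod_eq_of_lt (by omega),
      Nat.mod_eq_of_lt (by omega)] at h2
    exact h2
  have hcard := Finset.card_le_card_of_injOn (s := R ×ˢ Finset.range s)
    (t := (Finset.univ : Finset (ZMod (2 * i)))) (fun p => e p.1 + p.2) (fun _ _ => by simp) (by
      rintro ⟨u, k⟩ hu ⟨v, l⟩ hv h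
      simp only [Finset.coe_product, mem_prod, Finset.mem_coe, Finset.mem_range] at hu hv
      rcases le_total l k with hlk | hlk
      · obtain ⟨rfl, rfl⟩ := key u hu.1 v hv.1 k l hu.2 hlk h
        rfl
      · obtain ⟨rfl, rfl⟩ := key v hv.1 u hu.1 l k hv.2 hlk h.symm
        rfl)
  simpa [ZMod.card] using hcard

end Cycle

/-- A set that has `J`-local reflection symmetries about the midpoints of `z` and `z + 1`, with `z`
in `S`, and that is found within distance `J` of every such `z`, has at least `|S|` points. -/
lemma card_reflections_le {M : ℕ} (L S : Finset (ZMod M)) (J : ℕ)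
    (hrefl : ∀ z ∈ S, ∀ t : ℤ, |t| ≤ J → (z + t ∈ L ↔ z + 1 - t ∈ L))
    (hcov : ∀ z ∈ S, ∃ t : ℤ, |t| ≤ J ∧ z + t ∈ L) : S.card ≤ L.card := by
  classical
  -- A point of `L` at or before `z` is reflected to one at or after `z + 1`, so `L` is always met
  -- on the forward side.
  have hex : ∀ z ∈ S, ∃ j : ℕ, j ≤ J ∧ z + 1 + j ∈ L := by
    intro z hz
    obtain ⟨t, ht, h⟩ := hcov z hz
    obtain ⟨h1, h2⟩ := abs_le.1 ht
    rcases le_or_gt t 0 with h0 | h0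
    · refine ⟨(-t).toNat, by omega, ?_⟩
      have := (hrefl z hz t ht).1 h
      have hc : (((-t).toNat : ℕ) : ZMod M) = -t := by
        rw [← Int.cast_natCast, Int.toNat_of_nonneg (by omega)]; push_cast; rfl
      rwa [hc, ← sub_eq_add_neg]
    · refine ⟨(t - 1).toNat, by omega, ?_⟩
      have hc : (((t - 1).toNat : ℕ) : ZMod M) = t - 1 := by
        rw [← Int.cast_natCast, Int.toNat_of_nonneg (by omega)]; push_cast; rfl
      rw [hc]
      convert h using 1
      ring
  have hmin : ∀ z ∈ S, ∃ j : ℕ, j ≤ J ∧ z + 1 + j ∈ L ∧ ∀ l < j, z + 1 + (l : ZMod M) ∉ L := by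
    intro z hz
    have h := hex z hz
    have hP : ∃ j : ℕ, z + 1 + (j : ZMod M) ∈ L := h.imp fun _ h => h.2
    obtain ⟨j, hj, hjL⟩ := h
    exact ⟨Nat.find hP, (Nat.find_min' hP hjL).trans hj, Nat.find_spec hP,
      fun l hl => Nat.find_min hP hl⟩
  choose! f hfJ hfL hfmin using hmin
  -- Each center is sent to the first point of `L` ahead of it. Suppose `z` and `w` share this
  -- point, `w` being closer to it. Its mirror image at `w` is again in `L`; this image, or its
  -- reflection at `z`, lies ahead of `z` and before the supposed first point.
  have key : ∀ z ∈ S, ∀ w ∈ S, f w < f z → z + 1 + (f z : ZMod M) = w + 1 + f w → False := by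
    intro z hz w hw hlt h
    have hwz : w = z + f z - f w := by linear_combination -h
    have h1 := (hrefl w hw (-(f w : ℤ)) (by rw [abs_neg, Nat.abs_cast]; exact_mod_cast hfJ w hw)).2 (by
      convert hfL w hw using 1; push_cast; ring)
    have h2 : z + (((f z : ℤ) - 2 * f w : ℤ) : ZMod M) ∈ L := by
      convert h1 using 1; push_cast; linear_combination -hwz
    have hJ := hfJ z hz
    -- The mirror image is at `z + (f z - 2 * f w)`: if this is not ahead of `z`, it has to be
    -- reflected once more, at `z`.
    rcases le_or_gt ((f z : ℤ) - 2 * f w) 0 with h0 | h0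
    · have h3 := (hrefl z hz _ (by rw [abs_le]; constructor <;> omega)).1 h2
      refine hfmin z hz (2 * f w - f z) (by omega) ?_
      convert h3 using 1
      rw [Nat.cast_sub (by omega)]; push_cast; ring
    · refine hfmin z hz (f z - 2 * f w - 1) (by omega) ?_
      convert h2 using 1
      rw [Nat.cast_sub (by omega), Nat.cast_sub (by omega)]; push_cast; ring
  refine Finset.card_le_card_of_injOn (fun z => z + 1 + f z) hfL ?_
  intro z hz w hw h
  rcases lt_trichotomy (f w) (f z) with hlt | heq | hlt
  · exact (key z hz w hw hlt h).elim
  · simp only [heq] at h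
    simpa using h
  · exact (key w hw z hz hlt h.symm).elim

/-! ### Walks along a cycle -/

/-- The word of length `j` that alternates between `c` and `c'`; `c` is applied first. -/
def altWord : Color → Color → ℕ → List Color
  | _, _, 0 => []
  | c, c', j + 1 => altWord c' c j ++ [c]

lemma length_altWord (c c' : Color) (j : ℕ) : (altWord c c' j).length = j := by
  induction j generalizing c c' with
  | zero => rfl
  | succ j ih => simp [altWord, ih]

/-- The word that moves a point `z` of the cycle with `Up c c' z` to `z + t`. -/
def walkWord (c c' : Color) (t : ℤ) : List Color :=
  if 0 ≤ t then altWord c c' t.natAbs else altWord c' c t.natAbs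

lemma length_walkWord (c c' : Color) (t : ℤ) : ((walkWord c c' t).length : ℤ) = |t| := by
  rw [walkWord]; split_ifs <;> simp [length_altWord]

namespace ColoredGraph

variable {V : Type*} (G : ColoredGraph V)

/-- The `D`-edge at `x` leads to a vertex without other edges. -/
def HasLeaf (x : V) : Prop :=
  G.step Color.D x ≠ x ∧ ∀ c, c ≠ Color.D → G.step c (G.step Color.D x) = G.step Color.D x

/-- A leaf at the end of `w` is recognized from the words `w`, `D w` and `c D w`, which accounts for
the two extra letters. -/
lemma hasLeaf_wordStep_iff {r : ℕ} {x y : V} (h : G.rtype r x = G.rtype r y) (w : List Color)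
    (hw : w.length + 2 ≤ r) : G.HasLeaf (G.wordStep w x) ↔ G.HasLeaf (G.wordStep w y) := by
  rw [rtype_eq_iff, ballEquiv_iff_samePattern] at h
  have h1 := (h (Color.D :: w) w (by simp; omega) (by omega)).1
  have h2 := fun c => (h (c :: Color.D :: w) (Color.D :: w) (by simp; omega) (by simp; omega)).1
  exact and_congr (not_congr h1) (forall_congr' fun c => imp_congr_right fun _ => h2 c)

variable {G} {i : ℕ} {P : ZMod (2 * i) → V}
  (hP : ∀ {c c' : Color} {z : ZMod (2 * i)}, Up c c' z →
    G.step c (P z) = P (z + 1) ∧ G.step c' (P z) = P (z - 1))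

include hP in
lemma wordStep_altWord {c c' : Color} {z : ZMod (2 * i)} (h : Up c c' z) (j : ℕ) :
    G.wordStep (altWord c c' j) (P z) = P (z + j) ∧
      G.wordStep (altWord c' c j) (P z) = P (z - j) := by
  induction j generalizing c c' z with
  | zero => simp [altWord, wordStep]
  | succ j ih =>
    rw [altWord, altWord, wordStep_append, wordStep_append, (hP h).1, (hP h).2, (ih h.succ).1,
      (ih h.pred).2]
    push_cast
    constructor <;> congr 1 <;> ring

include hP in
lemma wordStep_walkWord {c c' : Color} {z : ZMod (2 * i)} (h : Up c c' z) (t : ℤ) :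
    G.wordStep (walkWord c c' t) (P z) = P (z + t) := by
  rw [walkWord]
  split_ifs with h0
  · rw [(wordStep_altWord hP h _).1, ← Int.cast_natCast, Int.natAbs_of_nonneg h0]
  · rw [(wordStep_altWord hP h _).2, ← Int.cast_natCast, Int.ofNat_natAbs_of_nonpos (by omega)]
    push_cast; congr 1; ring

include hP in
-- At points of opposite parity the same word runs in opposite directions. Hence equal types at `z`
-- and `z + 1` give a reflection, while equal types at `z - 1` and `z + 1` give a translation by 2.
lemma wordStep_walkWord' {c c' : Color} {z : ZMod (2 * i)} (h : Up c' c z) (t : ℤ) :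
    G.wordStep (walkWord c c' t) (P z) = P (z - t) := by
  rw [walkWord]
  split_ifs with h0
  · rw [(wordStep_altWord hP h _).2, ← Int.cast_natCast, Int.natAbs_of_nonneg h0]
  · rw [(wordStep_altWord hP h _).1, ← Int.cast_natCast, Int.ofNat_natAbs_of_nonpos (by omega)]
    push_cast; congr 1; ring

include hP in
open Classical in
/-- If leaves are attached to a cycle so that they are found everywhere within distance `J` and are
not invariant under translation by `2`, then the points of the cycle whose local type is that of
one of their `A`- and `B`-neighbors, or for which these neighbors have the same type, are at most
twice as many as the leaves. -/
lemma card_not_twoNeighbors_le [NeZero (2 * i)] {J : ℕ}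
    (hcov : ∀ z, ∃ t : ℤ, |t| ≤ J ∧ G.HasLeaf (P (z + t)) ∧
      ¬ (G.HasLeaf (P (z + t + 2)) ∧ G.HasLeaf (P (z + t + 4)))) :
    (Finset.univ.filter fun z => ¬ G.toTypeSpace (P z) ∈ G.twoNeighbors (J + 10)).card ≤
      2 * (Finset.univ.filter fun z => G.HasLeaf (P z)).card := by
  set r := J + 10 with hr
  set L := Finset.univ.filter fun z => G.HasLeaf (P z) with hL
  set S := Finset.univ.filter fun z => G.rtype r (P z) = G.rtype r (P (z + 1)) with hS
  have hSL : S.card ≤ L.card := by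
    refine card_reflections_le L S J ?_ ?_
    · intro z hz t ht
      obtain ⟨c, c', hup⟩ := exists_up z
      have h := G.hasLeaf_wordStep_iff (Finset.mem_filter.1 hz).2 (walkWord c c' t) (by
        have := length_walkWord c c' t
        omega)
      rw [wordStep_walkWord hP hup, wordStep_walkWord' hP hup.succ] at h
      simpa [hL] using h
    · intro z _
      obtain ⟨t, ht, h, -⟩ := hcov z
      exact ⟨t, ht, by simpa [hL] using h⟩
  -- A bad `z` shares its type with its successor, or with its predecessor, or its two neighbors
  -- share theirs. The first two cases give `S` and its shift; the third is impossible.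
  have hsub : (Finset.univ.filter fun z => ¬ G.toTypeSpace (P z) ∈ G.twoNeighbors r) ⊆
      S ∪ S.image (fun z => z + 1) := by
    intro z hz
    by_contra hzS
    simp only [Finset.mem_union, Finset.mem_image, not_or, not_exists, not_and] at hzS
    obtain ⟨h1, h2⟩ := hzS
    have e1 : G.rtype r (P z) ≠ G.rtype r (P (z + 1)) := fun h =>
      h1 (Finset.mem_filter.2 ⟨Finset.mem_univ _, h⟩)
    have e2 : G.rtype r (P z) ≠ G.rtype r (P (z - 1)) := fun h =>
      h2 (z - 1) (Finset.mem_filter.2 ⟨Finset.mem_univ _, by rw [sub_add_cancel]; exact h.symm⟩)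
        (by ring)
    -- Invariance under translation by 2 would carry the leaf at `z + t` to `z + t + 2` and `z + t +
    -- 4`, against `hcov`. The displacements used are at most `J + 3` in absolute value, within the
    -- range `r - 2 = J + 8`.
    have e3 : G.rtype r (P (z + 1)) ≠ G.rtype r (P (z - 1)) := by
      intro h
      obtain ⟨c, c', hup⟩ := exists_up z
      have htr : ∀ t : ℤ, |t| ≤ r - 2 →
          (G.HasLeaf (P (z + 1 + t)) ↔ G.HasLeaf (P (z - 1 + t))) := by
        intro t ht
        have h := G.hasLeaf_wordStep_iff h (walkWord c' c t) (by
          have := length_walkWord c' c t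
          omega)
        rwa [wordStep_walkWord hP hup.succ, wordStep_walkWord hP hup.pred] at h
      obtain ⟨t, ht, h0, hn⟩ := hcov z
      rw [abs_le] at ht
      have h2 : G.HasLeaf (P (z + t + 2)) := by
        have := (htr (t + 1) (by rw [abs_le]; constructor <;> omega)).2 (by
          convert h0 using 2; push_cast; ring)
        convert this using 2; push_cast; ring
      refine hn ⟨h2, ?_⟩
      have := (htr (t + 3) (by rw [abs_le]; constructor <;> omega)).2 (by
        convert h2 using 2; push_cast; ring)
      convert this using 2; push_cast; ring
    refine (Finset.mem_filter.1 hz).2 ?_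
    obtain ⟨c, c', hup⟩ := exists_up z
    obtain ⟨s1, s2⟩ := hP hup
    simp only [twoNeighbors, mem_ofPred_eq, spaceStep_toTypeSpace]
    rcases hup with ⟨rfl, rfl, -⟩ | ⟨rfl, rfl, -⟩
    · rw [s1, s2]
      exact ⟨e1.symm, e2.symm, e3⟩
    · rw [s1, s2]
      exact ⟨e2.symm, e1.symm, e3.symm⟩
  calc _ ≤ (S ∪ S.image (fun z => z + 1)).card := Finset.card_le_card hsub
    _ ≤ S.card + S.card := (Finset.card_union_le _ _).trans
        (Nat.add_le_add_left Finset.card_image_le _)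
    _ ≤ 2 * L.card := by omega

end ColoredGraph

end TypeSpaceAction

namespace TypeSpaceAction

/-! ### Lengths of the paths, edges of Cayley graphs, a geometric sum -/

lemma length_of_mem_wordsOfLength {k : ℕ} {w : List Color} (h : w ∈ wordsOfLength k) :
    w.length = k := by
  induction k generalizing w with
  | zero => simp [wordsOfLength] at h; simp [h]
  | succ k ih =>
    simp only [wordsOfLength, List.mem_flatMap, List.mem_map, List.mem_filter] at h
    obtain ⟨c, -, v, ⟨hv, -⟩, rfl⟩ := h
    simp [ih hv]

lemma length_word_le (n : ℕ) : (word n).length ≤ n := by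
  rw [word]
  cases h : ((List.range n).flatMap fun k => wordsOfLength (k + 1))[n - 1]? with
  | none => simp
  | some w =>
    have := List.mem_of_getElem? h
    simp only [List.mem_flatMap, List.mem_range] at this
    obtain ⟨k, hk, hw⟩ := this
    rw [Option.getD_some, length_of_mem_wordsOfLength hw]
    exact hk

lemma length_pathColors_le (n : ℕ) : (pathColors n).length ≤ n + 1 := by
  have h1 : (stepWord n).length ≤ n := by
    rw [stepWord]
    split_ifs with h
    · exact (length_word_le 1).trans (by omega)
    · exact length_word_le n
  rw [pathColors]
  split_ifs <;> simp <;> omega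

/-- `A`, `B`, `C` generate the whole group, so a proper subgroup misses one of them. -/
lemma exists_gen_notMem {N : Subgroup GamTilde} (h : N ≠ ⊤) :
    ∃ (c : Color) (g : GamTilde), c ≠ Color.D ∧ (g : Gam) = gen c ∧ g ∉ N := by
  by_contra! hcon
  refine h ?_
  have hle : GamTilde ≤ N.map GamTilde.subtype := by
    refine (Subgroup.closure_le _).2 ?_
    have hmem : ∀ c, c ≠ Color.D → gen c ∈ GamTilde → gen c ∈ N.map GamTilde.subtype :=
      fun c hc h => ⟨⟨gen c, h⟩, hcon c ⟨gen c, h⟩ hc rfl, rfl⟩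
    rintro _ (rfl | rfl | rfl)
    · exact hmem _ (by decide) (Subgroup.subset_closure (by simp))
    · exact hmem _ (by decide) (Subgroup.subset_closure (by simp))
    · exact hmem _ (by decide) (Subgroup.subset_closure (by simp))
  rw [eq_top_iff]
  intro g _
  obtain ⟨g', hg', h⟩ := hle g.2
  rwa [← Subtype.ext h]

/-- By normality, a generator outside `N` fixes no coset: `g a N = a N` would put a conjugate of
`g`, hence `g`, into `N`. -/
lemma exists_cayleyEdge {N : Subgroup GamTilde} [N.Normal] (h : N ≠ ⊤) (u : GamTilde ⧸ N) :
    ∃ c v, cayleyEdge N c u v := by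
  obtain ⟨c, g, hc, hg, hgN⟩ := exists_gen_notMem h
  refine ⟨c, g • u, hc, ?_, g, hg, rfl⟩
  intro hu
  induction u using QuotientGroup.induction_on with
  | H a =>
    have h1 : (a : GamTilde ⧸ N) = ((g * a : GamTilde) : GamTilde ⧸ N) := hu
    rw [QuotientGroup.eq] at h1
    apply hgN
    have := (inferInstance : N.Normal).conj_mem _ h1 a
    simpa [mul_assoc] using this

lemma mul_sum_le_of_geometric {a : ℕ → ℕ} {m h k : ℕ} (hm : 2 ≤ m)
    (ha : ∀ j ∈ Finset.Icc 1 k, a j * (2 * m ^ j) ≤ h) : m * ∑ j ∈ Finset.Icc 1 k, a j ≤ h := by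
  have hm' : (2 : ℝ) ≤ m := by exact_mod_cast hm
  have hm0 : (0 : ℝ) < m := by linarith
  -- The term `1 / m ^ k` is there for the induction: the next summand contributes half of it, and
  -- `1 / m ^ (k + 1)` is at most the other half because `m ≥ 2`.
  have hsum : ∀ k, m * ∑ j ∈ Finset.Icc 1 k, (1 / (2 * m ^ j) : ℝ) ≤ 1 - 1 / m ^ k := by
    intro k
    induction k with
    | zero => simp
    | succ k ih =>
      rw [Finset.sum_Icc_succ_top (by omega), mul_add]
      have h1 : (m : ℝ) * (1 / (2 * m ^ (k + 1))) = 1 / m ^ k * (1 / 2) := by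
        field_simp
        rw [pow_succ, mul_comm]
      have h2 : (1 : ℝ) / m ^ (k + 1) ≤ 1 / m ^ k * (1 / 2) := by
        rw [div_mul_div_comm, one_mul, pow_succ]
        gcongr
      linarith
  have h1 : (m * ∑ j ∈ Finset.Icc 1 k, a j : ℝ) ≤ h := by
    calc (m * ∑ j ∈ Finset.Icc 1 k, a j : ℝ)
        ≤ m * ∑ j ∈ Finset.Icc 1 k, h * (1 / (2 * m ^ j) : ℝ) := by
          push_cast
          gcongr with j hj
          rw [mul_one_div, le_div_iff₀ (by positivity)]
          exact_mod_cast ha j hj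
      _ = h * (m * ∑ j ∈ Finset.Icc 1 k, (1 / (2 * m ^ j) : ℝ)) := by
          rw [← Finset.mul_sum]; ring
      _ ≤ h * 1 := by
          gcongr
          refine (hsum k).trans ?_
          have : (0 : ℝ) ≤ 1 / m ^ k := by positivity
          linarith
      _ = h := mul_one _
  exact_mod_cast h1

/-! ### Vertices of Ω_n and their neighbors -/

namespace GluingData

variable (K : GluingData)

noncomputable instance instFintypeW (n : ℕ) : Fintype (K.W n) := @Fintype.ofFinite _ (K.finite_W n)

/-- A vertex of `H_n` as a vertex of the graph. -/
def ofH {n : ℕ} (hn : 1 ≤ n) (w : K.W n) : K.Vert := ⟨.main n w, hn⟩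

lemma ofH_injective {n : ℕ} (hn : 1 ≤ n) : Function.Injective (K.ofH hn) := by
  intro u v h
  have := congrArg Subtype.val h
  simpa [ofH] using this

lemma mem_stage {n : ℕ} {v : K.Vert} : v ∈ K.stage n ↔ v.1.level ≤ n := by
  simp [stage]

lemma mem_Omega {n : ℕ} (hn : 1 ≤ n) {v : K.Vert} : v ∈ K.Omega n ↔ v.1.level = n := by
  simp only [Omega, Finset.mem_sdiff, mem_stage]
  omega

lemma card_W_le_card_Omega {n : ℕ} (hn : 1 ≤ n) : Fintype.card (K.W n) ≤ (K.Omega n).card := by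
  refine Finset.card_le_card_of_injOn (s := Finset.univ) (K.ofH hn) (fun w _ => ?_)
    (K.ofH_injective hn).injOn
  exact (K.mem_Omega hn).2 rfl

lemma s_mono {m : ℕ} (hm : 1 ≤ m) {i j : ℕ} (hij : i ≤ j) : K.s m i ≤ K.s m j := by
  refine Nat.mul_le_mul (Nat.pow_le_pow_right hm hij) (Nat.pow_le_pow_right (by norm_num) ?_)
  refine Finset.card_le_card fun v hv => ?_
  rw [mem_stage] at hv ⊢
  omega

lemma pow_le_s (m n : ℕ) : m ^ n ≤ K.s m n :=
  Nat.le_mul_of_pos_right _ (by positivity)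

open Classical in
/-- The vertices of `Ω_n` with a given property are vertices of `H_n`, lie in a copy of a smaller
graph, or lie on the path. -/
lemma card_filter_Omega_le {n : ℕ} (hn : 1 ≤ n) (Q : K.Vert → Prop) :
    ((K.Omega n).filter Q).card ≤ (Finset.univ.filter fun w => Q (K.ofH hn w)).card +
      (∑ u ∈ Finset.univ.filter (fun u => K.cls n u < n), (K.stage (K.cls n u - 1)).card) +
      ((Finset.range (pathColors n).length).filter fun j =>
        ∃ h : (Vertex.path (K := K) n j).Valid, Q ⟨.path n j, h⟩).card := by
  -- The copies are counted in full, whether or not `Q` holds there, since their total size is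
  -- small.
  let T : Finset K.Vertex :=
    ((Finset.univ.filter fun w => Q (K.ofH hn w)).image (Vertex.main n) ∪
      (Finset.univ.filter (fun u => K.cls n u < n)).biUnion fun u =>
        (K.stage (K.cls n u - 1)).image fun v => Vertex.copy n u v.1) ∪
      ((Finset.range (pathColors n).length).filter fun j =>
        ∃ h : (Vertex.path (K := K) n j).Valid, Q ⟨.path n j, h⟩).image (Vertex.path n)
  have h1 : ((K.Omega n).filter Q).card ≤ T.card := by
    refine Finset.card_le_card_of_injOn Subtype.val ?_ Subtype.val_injective.injOn
    rintro ⟨v, hv⟩ hvQ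
    simp only [Finset.coe_filter, K.mem_Omega hn] at hvQ
    obtain ⟨hl, hQ⟩ := hvQ
    cases v with
    | base => simp only [Vertex.level] at hl; omega
    | main k w =>
      obtain rfl : k = n := hl
      exact Finset.mem_union_left _ (Finset.mem_union_left _ (Finset.mem_image_of_mem _
        (Finset.mem_filter.2 ⟨Finset.mem_univ _, hQ⟩)))
    | copy k u v =>
      obtain rfl : k = n := hl
      obtain ⟨hv1, hv2, hv3⟩ := hv
      refine Finset.mem_union_left _ (Finset.mem_union_right _ (Finset.mem_biUnion.2
        ⟨u, Finset.mem_filter.2 ⟨Finset.mem_univ _, hv3⟩, Finset.mem_image.2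
          ⟨⟨v, hv1⟩, K.mem_stage.2 (by simp only; omega), rfl⟩⟩))
    | path k j =>
      obtain rfl : k = n := hl
      exact Finset.mem_union_right _ (Finset.mem_image_of_mem _
        (Finset.mem_filter.2 ⟨Finset.mem_range.2 hv.2, hv, hQ⟩))
  refine h1.trans ((Finset.card_union_le _ _).trans (add_le_add ((Finset.card_union_le _ _).trans
    (add_le_add Finset.card_image_le (Finset.card_biUnion_le.trans ?_))) Finset.card_image_le))
  exact Finset.sum_le_sum fun u _ => Finset.card_image_le

lemma exists_edge_of_step_ne {V : Type*} {G : ColoredGraph V} {c : Color} {v : V}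
    (h : G.step c v ≠ v) : G.edge c v (G.step c v) := by
  by_cases h' : ∃ w, G.edge c v w
  · obtain ⟨w, hw⟩ := h'
    rwa [G.step_of_edge hw]
  · exact (h (G.step_of_not h')).elim

lemma not_threeSteps_path {n j : ℕ} (h : (Vertex.path (K := K) n j).Valid) :
    ¬ K.graph.ThreeSteps ⟨.path n j, h⟩ := by
  rintro ⟨c₁, c₂, c₃, h1, h2, h3, h12, h13, h23⟩
  have key : ∀ c, K.graph.step c ⟨.path n j, h⟩ ≠ ⟨.path n j, h⟩ →
      (K.graph.step c ⟨.path n j, h⟩).1 = .path n (j + 1) ∨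
      (K.graph.step c ⟨.path n j, h⟩).1 = K.pathPrev n j := fun c hc =>
    (K.edge_path (exists_edge_of_step_ne hc)).imp And.left And.right
  -- Pigeonhole: three distinct neighbors, but only the next and the previous vertex are available.
  rcases key c₁ h1 with e1 | e1 <;> rcases key c₂ h2 with e2 | e2 <;>
    rcases key c₃ h3 with e3 | e3
  · exact h12 (Subtype.ext (e1.trans e2.symm))
  · exact h12 (Subtype.ext (e1.trans e2.symm))
  · exact h13 (Subtype.ext (e1.trans e3.symm))
  · exact h23 (Subtype.ext (e2.trans e3.symm))
  · exact h23 (Subtype.ext (e2.trans e3.symm))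
  · exact h13 (Subtype.ext (e1.trans e3.symm))
  · exact h12 (Subtype.ext (e1.trans e2.symm))
  · exact h12 (Subtype.ext (e1.trans e2.symm))

/-! ### Leaves attached to H_n -/

variable {K} {n : ℕ}

lemma graph_edge_ofH (hn : 1 ≤ n) {c : Color} {u v : K.W n} (h : (K.H n).edge c u v) :
    K.graph.edge c (K.ofH hn u) (K.ofH hn v) :=
  Or.inl (.main h)

lemma not_hasLeaf {V : Type*} {G : ColoredGraph V} {c : Color} {x y z : V}
    (h : G.edge Color.D x y) (hc : c ≠ Color.D) (h' : G.edge c y z) : ¬ G.HasLeaf x := by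
  rintro ⟨-, h1⟩
  have h2 := h1 c hc
  rw [G.step_of_edge h, G.step_of_edge h'] at h2
  subst h2
  exact G.irrefl h'

/-- The copy of `G_0` attached to a point of `R_1` is a single vertex: the only edge at `base` leads
to level 1, which is outside the copy. -/
lemma hasLeaf_of_cls (hn : 2 ≤ n) {w : K.W n} (hw : K.cls n w = 1) :
    K.graph.HasLeaf (K.ofH (by omega) w) := by
  have hv : (Vertex.copy n w .base : K.Vertex).Valid := ⟨trivial, by simp [Vertex.level, hw], by omega⟩
  have he : K.graph.edge Color.D (K.ofH (by omega) w) ⟨_, hv⟩ :=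
    Or.inl (.attach (by omega) (by omega) (by rw [hw]; rfl))
  refine ⟨?_, fun c hc => ?_⟩
  · rw [K.graph.step_of_edge he]
    intro h
    cases congrArg Subtype.val h
  · rw [K.graph.step_of_edge he]
    refine K.graph.step_of_not ?_
    rintro ⟨y, hy⟩
    rcases K.edge_copy hy with ⟨v', h1, -, h2, -⟩ | ⟨h1, -⟩
    · rw [(K.edge_base h1).2] at h2
      simp only [Vertex.level] at h2
      omega
    · exact hc h1

/-- If no vertex of the graphs `H_k` is isolated, then leaves are attached in `H_n` only to the
points of `R_1` and possibly to `x_n`. -/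
lemma cls_of_hasLeaf (hH : ∀ k, 1 ≤ k → ∀ w : K.W k, ∃ c w', (K.H k).edge c w w')
    (hcls : ∀ w, 1 ≤ K.cls n w) (hn : 2 ≤ n)
    {w : K.W n} (h : K.graph.HasLeaf (K.ofH (by omega) w)) : K.cls n w = 1 ∨ w = K.x n := by
  have hne : ∀ {k : ℕ} {c : Color} {u v : K.W k}, (K.H k).edge c u v → c ≠ Color.D := by
    rintro k c u v h rfl
    exact K.not_D _ _ _ h
  have hedge := exists_edge_of_step_ne h.1
  set y := K.graph.step Color.D (K.ofH (by omega) w)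
  -- The `D`-neighbor of `w` is `q_{n+1}`, `r_{n-1}`, the root of an attached copy, or the start of
  -- the path. In the first two cases, and in the third unless the copy is one of `G_0`, it lies in
  -- some `H_k` or in a copy of one, and so has a further edge.
  rcases K.edge_main hedge with ⟨w', h1, -⟩ | ⟨-, ⟨-, -, hy⟩ | ⟨-, -, hy⟩ | ⟨-, h2, hy⟩ | ⟨-, hx, -⟩⟩
  · exact (K.not_D _ _ _ h1).elim
  · obtain ⟨c, w', hw'⟩ := hH (n + 1) (by omega) (K.q (n + 1))
    refine (not_hasLeaf hedge (hne hw') (z := K.ofH (by omega) w') (Or.inl ?_) h).elim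
    rw [hy]
    exact .main hw'
  · obtain ⟨k, rfl⟩ : ∃ k, n = k + 2 := ⟨n - 2, by omega⟩
    obtain ⟨c, w', hw'⟩ := hH (k + 1) (by omega) (K.r (k + 1))
    refine (not_hasLeaf hedge (hne hw') (z := K.ofH (by omega) w') (Or.inl ?_) h).elim
    rw [hy]
    exact .main hw'
  · by_cases h1 : K.cls n w = 1
    · exact Or.inl h1
    · obtain ⟨k, hk⟩ : ∃ k, K.cls n w = k + 2 := ⟨K.cls n w - 2, by have := hcls w; omega⟩
      obtain ⟨c, w', hw'⟩ := hH (k + 1) (by omega) (K.r (k + 1))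
      have hv : (Vertex.copy n w (.main (k + 1) w') : K.Vertex).Valid :=
        ⟨Nat.le_add_left 1 k, by simp only [Vertex.level]; omega, h2⟩
      refine (not_hasLeaf hedge (hne hw') (z := ⟨_, hv⟩) (Or.inl ?_) h).elim
      rw [hy, hk]
      exact .copy (.main hw') (by simp only [Vertex.level_root]; omega)
        (by simp only [Vertex.level]; omega)
  -- This case does occur: if the path is a single edge, `x_n` carries a leaf.
  · exact Or.inr hx

/-! ### Counting on the cycle H_n for even n -/

section Even

variable {m i : ℕ} {N : ℕ → Subgroup GamTilde} (hm : 10 < m) (hK : IsMainConstruction N m K)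

include hm hK in
-- Only the Cayley graph of the trivial quotient has an isolated vertex; it has diameter 0, which
-- the lower bound on the diameter of `H_k` excludes.
lemma exists_H_edge (hN : ∀ i, (N i).Normal) {k : ℕ} (hk : 1 ≤ k) (w : K.W k) :
    ∃ c w', (K.H k).edge c w w' := by
  have transfer : ∀ {T : Type} {R : Color → T → T → Prop} (_ : (K.H k).IsoTo R)
      (_ : ∀ t, ∃ c t', R c t t'), ∃ c w', (K.H k).edge c w w' := by
    rintro T R ⟨e, he⟩ h
    obtain ⟨c, t', ht⟩ := h (e w)
    exact ⟨c, e.symm t', (he _ _ _).2 (by simpa using ht)⟩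
  rcases Nat.lt_or_ge k 2 with hk2 | hk2
  · obtain rfl : k = 1 := by omega
    refine transfer hK.H_one fun t => ?_
    fin_cases t
    · exact ⟨.A, 1, by simp [triangleEdge]⟩
    · exact ⟨.B, 2, by simp [triangleEdge]⟩
    · exact ⟨.C, 0, by simp [triangleEdge]⟩
  · rcases Nat.even_or_odd k with hev | hodd
    · obtain ⟨i, hi, hiso⟩ := hK.H_even k hk2 hev
      have : NeZero (2 * i) := ⟨by omega⟩
      refine transfer hiso fun t => ?_
      obtain ⟨c, c', h⟩ := exists_up t
      exact ⟨c, _, h.cycleEdge_succ⟩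
    · obtain ⟨i, hiso⟩ := hK.H_odd k hk2 hodd
      have := hN i
      refine transfer hiso fun t => exists_cayleyEdge (fun htop => ?_) t
      obtain ⟨e, -⟩ := hiso
      have hsub : Subsingleton (K.W k) := by
        have : Subsingleton (GamTilde ⧸ N i) := by
          rw [htop]
          exact QuotientGroup.subsingleton_quotient_top
        exact e.subsingleton
      have h1 := hK.le_diam k hk2
      rw [SimpleGraph.diam_eq_zero.2 (Or.inr hsub)] at h1
      have := (Nat.pow_pos (n := k) (by omega : 0 < m)).trans_le (K.pow_le_s m k)
      omega

variable (hn : 2 ≤ n) (e : K.W n ≃ ZMod (2 * i))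
  (he : ∀ c u v, (K.H n).edge c u v ↔ cycleEdge i c (e u) (e v)) [NeZero (2 * i)]

include hK hn he in
lemma s_le : 10 * K.s m n ≤ 2 * i :=
  (hK.le_diam n hn).trans (cycle_diam_le e he)

include hm hK hn he in
-- The cycle has length at least 10 m^n, exponential in `n`, so the path and the few special
-- vertices are negligible.
lemma mul_length_le : m * (n + 3) ≤ 2 * i := by
  have h1 := (Nat.mul_le_mul_left 10 (K.pow_le_s m n)).trans (s_le hK hn e he)
  obtain ⟨k, rfl⟩ : ∃ k, n = k + 2 := ⟨n - 2, by omega⟩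
  have h2 : k + 1 < m ^ (k + 1) := Nat.lt_pow_self (by omega)
  have h3 : m * (k + 2) ≤ m ^ (k + 2) := by
    rw [pow_succ, mul_comm]
    exact Nat.mul_le_mul_right _ h2
  nlinarith

include hm hK hn he in
lemma card_cls_mul_le {j : ℕ} (h1 : 1 ≤ j) (hj : j ≤ n) :
    (Finset.univ.filter fun u => K.cls n u = j).card * (2 * K.s m j) ≤ 2 * i := by
  refine cycle_card_mul_le e he ?_ _ ?_
  · have := s_le hK hn e he
    have := K.s_mono (m := m) (by omega) hj
    omega
  · intro u hu v hv huv
    exact hK.net n hn j h1 hj u v (Finset.mem_filter.1 hu).2 (Finset.mem_filter.1 hv).2 huv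

include hm hK hn he in
-- This is what s_j is designed for: in |R_j| · 2 m^j 2^{|V(G_{j-1})|} ≤ 2i the power of 2 dominates
-- the size of a copy plus 1 for its point of attachment, and the powers of `m` make the sum over
-- `j` geometric.
lemma mul_sum_copies_le :
    m * ∑ u ∈ Finset.univ.filter (fun u => K.cls n u < n), (1 + (K.stage (K.cls n u - 1)).card) ≤
      2 * i := by
  have hmaps : ∀ u ∈ Finset.univ.filter (fun u => K.cls n u < n),
      K.cls n u ∈ Finset.Icc 1 (n - 1) := by
    intro u hu
    have h1 := (hK.cls_mem n hn u).1
    have h2 := (Finset.mem_filter.1 hu).2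
    rw [Finset.mem_Icc]; omega
  rw [← Finset.sum_fiberwise_of_maps_to hmaps]
  refine mul_sum_le_of_geometric (by omega) fun j hj => ?_
  rw [Finset.mem_Icc] at hj
  have h2 : ∑ u ∈ (Finset.univ.filter (fun u => K.cls n u < n)).filter (fun u => K.cls n u = j),
      (1 + (K.stage (K.cls n u - 1)).card) =
      (Finset.univ.filter fun u => K.cls n u = j).card * (1 + (K.stage (j - 1)).card) := by
    rw [← smul_eq_mul, ← Finset.sum_const]
    refine Finset.sum_congr ?_ fun u hu => by rw [(Finset.mem_filter.1 hu).2]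
    ext u
    simp only [Finset.mem_filter, Finset.mem_univ, true_and]
    omega
  rw [h2]
  refine le_trans ?_ (card_cls_mul_le hm hK hn e he hj.1 (by omega))
  have h3 : 1 + (K.stage (j - 1)).card ≤ 2 ^ (K.stage (j - 1)).card := by
    have := Nat.lt_two_pow_self (n := (K.stage (j - 1)).card)
    omega
  calc _ = (Finset.univ.filter fun u => K.cls n u = j).card *
        (2 * (m ^ j * (1 + (K.stage (j - 1)).card))) := by ring
    _ ≤ _ := by unfold s; gcongr

omit [NeZero (2 * i)] in
include he in
-- The cycle supplies only edges of colors `A` and `B`, so a third neighbor comes from an edge of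
-- color `D`, and these sit at the listed vertices.
lemma threeSteps_ofH (hn1 : 1 ≤ n) {w : K.W n} (h : K.graph.ThreeSteps (K.ofH hn1 w)) :
    K.cls n w < n ∨ w ∈ ({K.q n, K.r n, K.x n} : Set (K.W n)) := by
  obtain ⟨c₁, c₂, c₃, h1, h2, h3, h12, h13, h23⟩ := h
  have hc : ∃ c, (c = Color.C ∨ c = Color.D) ∧
      K.graph.step c (K.ofH hn1 w) ≠ K.ofH hn1 w := by
    by_contra! hcon
    cases c₁ <;> cases c₂ <;> cases c₃ <;> simp_all
  obtain ⟨c, hc, hstep⟩ := hc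
  rcases K.edge_main (exists_edge_of_step_ne hstep) with
    ⟨w', h1, -⟩ | ⟨-, ⟨-, hw, -⟩ | ⟨-, hw, -⟩ | ⟨-, h2, -⟩ | ⟨-, hw, -⟩⟩
  · have := cycleEdge_color ((he _ _ _).1 h1)
    rcases hc with rfl | rfl <;> simp at this
  · simp [hw]
  · simp [hw]
  · exact Or.inl h2
  · simp [hw]

open Classical in
include hm hK hn he in
/-- Few vertices of `Ω_n`, `n` even, have more than two neighbors. -/
lemma mul_card_threeSteps_le :
    m * ((K.Omega n).filter K.graph.ThreeSteps).card ≤ 2 * (K.Omega n).card := by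
  have hn1 : 1 ≤ n := by omega
  have hpath : ((Finset.range (pathColors n).length).filter fun j =>
      ∃ h : (Vertex.path (K := K) n j).Valid, K.graph.ThreeSteps ⟨.path n j, h⟩) = ∅ :=
    Finset.filter_eq_empty_iff.2 fun j _ ⟨h, h'⟩ => K.not_threeSteps_path h h'
  have hmain : (Finset.univ.filter fun w => K.graph.ThreeSteps (K.ofH hn1 w)).card ≤
      (Finset.univ.filter fun u => K.cls n u < n).card + 3 := by
    refine (Finset.card_le_card (t := (Finset.univ.filter fun u => K.cls n u < n) ∪
      {K.q n, K.r n, K.x n}) fun w hw => ?_).trans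
      ((Finset.card_union_le _ _).trans (Nat.add_le_add_left Finset.card_le_three _))
    rcases threeSteps_ofH e he hn1 (Finset.mem_filter.1 hw).2 with h | h
    · exact Finset.mem_union_left _ (Finset.mem_filter.2 ⟨Finset.mem_univ _, h⟩)
    · exact Finset.mem_union_right _ (by simpa using h)
  have h1 := K.card_filter_Omega_le hn1 K.graph.ThreeSteps
  have h2 := mul_sum_copies_le hm hK hn e he
  have h3 := mul_length_le hm hK hn e he
  have h4 := K.card_W_le_card_Omega hn1
  rw [Fintype.card_congr e, ZMod.card] at h4
  rw [hpath, Finset.card_empty] at h1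
  rw [Finset.sum_add_distrib, ← Finset.card_eq_sum_ones] at h2
  -- The copies and their points of attachment cost one `2 * i`; the three vertices `q_n`, `r_n`,
  -- `x_n` are absorbed into `n + 3` and cost another.
  calc _ ≤ m * (((Finset.univ.filter fun u => K.cls n u < n).card +
        ∑ u ∈ Finset.univ.filter (fun u => K.cls n u < n), (K.stage (K.cls n u - 1)).card) + 3) :=
        Nat.mul_le_mul_left _ (by omega)
    _ ≤ 2 * i + m * (n + 3) := by
        rw [mul_add]
        exact add_le_add h2 (Nat.mul_le_mul_left _ (by omega))
    _ ≤ _ := by omega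

open Classical in
include hm hK hn he in
/-- Most vertices of `Ω_n`, `n` even, differ in their types from their `A`- and `B`-neighbors. -/
lemma mul_card_not_twoNeighbors_le (hN : ∀ i, (N i).Normal) :
    m * ((K.Omega n).filter fun v => ¬ K.graph.toTypeSpace v ∈
      K.graph.twoNeighbors (10 * K.s m 1 + 10)).card ≤ 3 * (K.Omega n).card := by
  have hn1 : 1 ≤ n := by omega
  -- The level depends on `m` only. Being the same for all `n`, it defines one open and closed set
  -- whose measure is the limit of the frequencies.
  set r := 10 * K.s m 1 + 10
  have hs1 : m ≤ K.s m 1 := by simpa using K.pow_le_s m 1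
  have hs := (K.s_mono (m := m) (by omega) hn1).trans
    ((Nat.le_mul_of_pos_left _ (by norm_num)).trans (s_le hK hn e he))
  have hcls : ∀ w, K.graph.HasLeaf (K.ofH hn1 w) → K.cls n w = 1 ∨ w = K.x n := fun w =>
    cls_of_hasLeaf (fun k hk => exists_H_edge hm hK hN hk) (fun w => (hK.cls_mem n hn w).1) hn
  let P : ZMod (2 * i) → K.Vert := fun z => K.ofH hn1 (e.symm z)
  have hP : ∀ {c c' : Color} {z : ZMod (2 * i)}, Up c c' z →
      K.graph.step c (P z) = P (z + 1) ∧ K.graph.step c' (P z) = P (z - 1) := fun h =>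
    ⟨K.graph.step_of_edge (graph_edge_ofH hn1 ((he _ _ _).2 (by simpa using h.cycleEdge_succ))),
      K.graph.step_of_edge (graph_edge_ofH hn1 ((he _ _ _).2 (by simpa using h.cycleEdge_pred)))⟩
  have hnat : ∀ k : ℕ, 0 < k → k < 5 → ((k : ℕ) : ZMod (2 * i)) ≠ 0 := by
    intro k h0 h5 h
    have := Nat.le_of_dvd h0 ((ZMod.natCast_eq_zero_iff _ _).1 h)
    omega
  -- Distinct points of `R_1` are at least `2 * s_1 ≥ 2 * m > 4` apart.
  have hnet : ∀ u : K.W n, K.cls n u = 1 → ∀ k : ℕ, 0 < k → k < 5 →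
      K.cls n (e.symm (e u + k)) ≠ 1 := by
    intro u hu k h0 h5 hk
    have h1 := hK.net n hn 1 le_rfl hn1 u _ hu hk (fun h => hnat k h0 h5 (by
      have := congrArg e h
      rw [e.apply_symm_apply] at this
      exact left_eq_add.1 this))
    have h2 := cycle_dist_le e he u k
    omega
  have hcov : ∀ z, ∃ t : ℤ, |t| ≤ (10 * K.s m 1 : ℕ) ∧ K.graph.HasLeaf (P (z + t)) ∧
      ¬ (K.graph.HasLeaf (P (z + t + 2)) ∧ K.graph.HasLeaf (P (z + t + 4))) := by
    intro z
    obtain ⟨p, hp, hd⟩ := hK.cover n hn 1 le_rfl hn1 (e.symm z)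
    rw [SimpleGraph.dist_comm] at hd
    obtain ⟨t, ht, hz⟩ := cycle_exists_of_dist_le e he hd
    rw [e.apply_symm_apply] at hz
    refine ⟨t, ht, ?_, ?_⟩
    · simp only [P, ← hz, e.symm_apply_apply]
      exact hasLeaf_of_cls hn hp
    -- Neither shift of `p` is in `R_1`, so two leaves there would both be at `x_n`. This is why two
    -- shifts are tested and not one.
    · rintro ⟨h2, h4⟩
      simp only [P, ← hz] at h2 h4
      have h2' := (hcls _ h2).resolve_left (by exact_mod_cast hnet p hp 2 (by norm_num) (by norm_num))
      have h4' := (hcls _ h4).resolve_left (by exact_mod_cast hnet p hp 4 (by norm_num) (by norm_num))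
      have h5 := e.symm.injective (h2'.trans h4'.symm)
      refine hnat 2 (by norm_num) (by norm_num) ?_
      push_cast
      linear_combination -h5
  have hcycle := ColoredGraph.card_not_twoNeighbors_le hP hcov
  have hleaf : (Finset.univ.filter fun z => K.graph.HasLeaf (P z)).card ≤
      (Finset.univ.filter fun u => K.cls n u = 1).card + 1 := by
    rw [← Finset.card_image_of_injective _ e.symm.injective]
    refine (Finset.card_le_card (t := (Finset.univ.filter fun u => K.cls n u = 1) ∪ {K.x n})
      fun w hw => ?_).trans
      ((Finset.card_union_le _ _).trans (by rw [Finset.card_singleton]))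
    obtain ⟨z, hz, rfl⟩ := Finset.mem_image.1 hw
    rcases hcls _ (Finset.mem_filter.1 hz).2 with h | h
    · exact Finset.mem_union_left _ (Finset.mem_filter.2 ⟨Finset.mem_univ _, h⟩)
    · exact Finset.mem_union_right _ (Finset.mem_singleton.2 h)
  obtain ⟨Q, hQ⟩ : ∃ Q : K.Vert → Prop, ∀ v, Q v ↔
      ¬ K.graph.toTypeSpace v ∈ K.graph.twoNeighbors r := ⟨_, fun _ => Iff.rfl⟩
  rw [← Finset.filter_congr fun v _ => hQ v]
  have hmain : (Finset.univ.filter fun w => Q (K.ofH hn1 w)).card ≤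
      2 * ((Finset.univ.filter fun u => K.cls n u = 1).card + 1) := by
    refine le_trans ?_ (hcycle.trans (Nat.mul_le_mul_left 2 hleaf))
    refine Finset.card_le_card_of_injOn e (fun w hw => ?_) e.injective.injOn
    simp only [Finset.coe_filter, mem_ofPred_eq, Finset.mem_univ, true_and, hQ] at hw ⊢
    simpa only [P, e.symm_apply_apply] using hw
  have h1 := K.card_filter_Omega_le hn1 Q
  have hpath := (Finset.card_filter_le (Finset.range (pathColors n).length) fun j =>
      ∃ h : (Vertex.path (K := K) n j).Valid, Q ⟨.path n j, h⟩)
  rw [Finset.card_range] at hpath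
  have hlen := length_pathColors_le n
  have h2 := mul_sum_copies_le hm hK hn e he
  rw [Finset.sum_add_distrib, ← Finset.card_eq_sum_ones] at h2
  have h3 := mul_length_le hm hK hn e he
  have h4 := K.card_W_le_card_Omega hn1
  rw [Fintype.card_congr e, ZMod.card] at h4
  have h5 := card_cls_mul_le hm hK hn e he le_rfl hn1
  have h6 : m * (2 * (Finset.univ.filter fun u => K.cls n u = 1).card) ≤ 2 * i := by
    refine le_trans ?_ h5
    calc _ = (Finset.univ.filter fun u => K.cls n u = 1).card * (2 * m) := by ring
      _ ≤ _ := by gcongr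
  -- Here `n + 3` is 2 for the possible leaf at `x_n`, which counts twice, plus `n + 1` for the
  -- path. Each of the three summands costs one `2 * i`.
  calc _ ≤ m * (2 * (Finset.univ.filter fun u => K.cls n u = 1).card +
        ((Finset.univ.filter fun u => K.cls n u < n).card +
        ∑ u ∈ Finset.univ.filter (fun u => K.cls n u < n), (K.stage (K.cls n u - 1)).card) +
        (n + 3)) := Nat.mul_le_mul_left _ (by omega)
    _ ≤ 2 * i + 2 * i + 2 * i := by
        rw [mul_add, mul_add]
        exact add_le_add (add_le_add h6 h2) h3
    _ ≤ _ := by omega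

end Even

end GluingData

end TypeSpaceAction

/-! ### Passage to the limit -/

namespace TypeSpaceAction

namespace GluingData

lemma card_le_div_mul {m k a b : ℕ} (hm : 0 < m) (h : m * a ≤ k * b) :
    (a : ℝ≥0∞) ≤ (k : ℝ≥0∞) / m * b := by
  rw [ENNReal.mul_comm_div, ← mul_div_assoc, ENNReal.le_div_iff_mul_le (by simp [hm.ne']) (by simp),
    mul_comm]
  exact_mod_cast h

variable {K : GluingData} {m : ℕ} {N : ℕ → Subgroup GamTilde}

lemma exists_cycle (hK : IsMainConstruction N m K) {n : ℕ} (hn : 1 ≤ n) :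
    ∃ i, NeZero (2 * i) ∧ ∃ e : K.W (2 * n) ≃ ZMod (2 * i),
      ∀ c u v, (K.H (2 * n)).edge c u v ↔ cycleEdge i c (e u) (e v) := by
  obtain ⟨i, hi, e, he⟩ := hK.H_even (2 * n) (by omega) (even_two_mul n)
  exact ⟨i, ⟨by omega⟩, e, he⟩

lemma Omega_nonempty {n : ℕ} (hn : 1 ≤ n) : (K.Omega n).Nonempty :=
  ⟨K.ofH hn (K.q n), (K.mem_Omega hn).2 rfl⟩

open Classical in
lemma eventually_card_threeSteps_le (hm : 10 < m) (hK : IsMainConstruction N m K)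
    {l : Filter ℕ} (hl : ∀ᶠ n in l, 1 ≤ n) :
    ∀ᶠ n in l, (((K.Omega (2 * n)).filter K.graph.ThreeSteps).card : ℝ≥0∞) ≤
      2 / m * (K.Omega (2 * n)).card := by
  refine hl.mono fun n hn => ?_
  obtain ⟨i, _, e, he⟩ := exists_cycle hK hn
  exact_mod_cast card_le_div_mul (k := 2) (by omega)
    (mul_card_threeSteps_le hm hK (by omega) e he)

open Classical in
lemma eventually_card_not_twoNeighbors_le (hm : 10 < m) (hK : IsMainConstruction N m K)
    (hN : ∀ i, (N i).Normal) {l : Filter ℕ} (hl : ∀ᶠ n in l, 1 ≤ n) :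
    ∀ᶠ n in l, (((K.Omega (2 * n)).filter fun v => ¬ K.graph.toTypeSpace v ∈
      K.graph.twoNeighbors (10 * K.s m 1 + 10)).card : ℝ≥0∞) ≤
      3 / m * (K.Omega (2 * n)).card := by
  refine hl.mono fun n hn => ?_
  obtain ⟨i, _, e, he⟩ := exists_cycle hK hn
  exact_mod_cast card_le_div_mul (k := 3) (by omega)
    (mul_card_not_twoNeighbors_le hm hK (by omega) e he hN)

end GluingData

end TypeSpaceAction

theorem mainTheorem3
    (N : ℕ → Subgroup TypeSpaceAction.GamTilde) (hN : Antitone N)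
    (hN_normal : ∀ i, (N i).Normal) (hN_fin : ∀ i, (N i).FiniteIndex) (hN_inf : ⨅ i, N i = ⊥)
    (ω : Ultrafilter ℕ) (hω : (ω : Filter ℕ) ≤ Filter.cofinite)
    (K : ℕ → TypeSpaceAction.GluingData)
    (hK : ∀ m, 10 < m → TypeSpaceAction.IsMainConstruction N m (K m)) :
    (∀ m, 10 < m →
      (K m).mu1 ω {x | 2 < TypeSpaceAction.degree (K m).graph.graphing x} ≤ 2 / (m : ℝ≥0∞)) ∧
    Tendsto (fun m => TypeSpaceAction.edgeMeasure (K m).graph.graphing ((K m).mu1 ω)) atTop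
      (𝓝 1) := by
  -- Nonprincipality is needed only to discard `n = 0`; for `n ≥ 1` the graph H_{2n} is a cycle.
  have h1 : ∀ᶠ n in (ω : Filter ℕ), 1 ≤ n := by
    rw [Nat.cofinite_eq_atTop] at hω
    exact hω (eventually_ge_atTop 1)
  have hthree := fun m hm => TypeSpaceAction.GluingData.eventually_card_threeSteps_le hm (hK m hm) h1
  refine ⟨fun m hm => ?_, ?_⟩
  · exact (measure_mono (K m).graph.two_lt_degree_subset).trans
      ((K m).graph.averageMeasure_iUnion_threeNeighbors_le ω _ (hthree m hm))
  -- The edge measure is squeezed between `1 - 3 / m` and `1 + 2 / m`.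
  · have hbounds := fun m (hm : 10 < m) => (K m).graph.edgeMeasure_bounds ω
      (fun n => (K m).Omega (2 * n))
      (h1.mono fun n hn => TypeSpaceAction.GluingData.Omega_nonempty (by omega)) (hthree m hm)
      (TypeSpaceAction.GluingData.eventually_card_not_twoNeighbors_le hm (hK m hm) hN_normal h1)
    have hdiv : ∀ k : ℝ≥0∞, k ≠ ⊤ → Tendsto (fun m : ℕ => k / (m : ℝ≥0∞)) atTop (𝓝 0) := by
      intro k hk
      simpa [div_eq_mul_inv] using
        ENNReal.Tendsto.const_mul ENNReal.tendsto_inv_nat_nhds_zero (Or.inr hk)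
    have hlow : Tendsto (fun m : ℕ => 1 - 3 / (m : ℝ≥0∞)) atTop (𝓝 1) := by
      simpa using ENNReal.Tendsto.sub tendsto_const_nhds (hdiv 3 (by simp)) (Or.inl (by simp))
    have hup : Tendsto (fun m : ℕ => 1 + 2 / (m : ℝ≥0∞)) atTop (𝓝 1) := by
      simpa using tendsto_const_nhds.add (hdiv 2 (by simp))
    exact tendsto_of_tendsto_of_tendsto_of_le_of_le' hlow hup
      ((eventually_gt_atTop 10).mono fun m hm => (hbounds m hm).1)
      ((eventually_gt_atTop 10).mono fun m hm => (hbounds m hm).2)
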